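/- Let $d\ge 1$, $N>2$, $p\in(1,\infty)$ with $p\ne 2$, and let $\lambda_1,\dots,\lambda_N>0$ with $\sum_{i=1}^N\lambda_i=1$. For points $x_1,\dots,x_N\in\mathbb{R}^d$ let $\overline{x}_p(x_1,\dots,x_N)$ be the unique minimizer of $z\mapsto\sum_{i=1}^N\lambda_i|x_i-z|^p$. Let $B\subset\mathbb{R}^d$ be a bounded open set of Lebesgue measure $1$, let $\hat x_2,\dots,\hat x_N\in\mathbb{R}^d$ be points that are not all equal, and put $\mu_1:=\mathbf{1}_B\,dx$ and $\mu_i:=\delta_{\hat x_i}$ for $i=2,\dots,N$. Let $\overline{z}_p$ be the unique minimizer of $z\mapsto\sum_{i=2}^N\lambda_i|\hat x_i-z|^p$, and let $\mathrm{bar}_p(x_1):=\overline{x}_p(x_1,\hat x_2,\dots,\hat x_N)$. (1) Suppose $p>2$ and $\overline{z}_p\in B$. Then the $p$-Wasserstein barycenter $\nu_p$ of $\mu_1,\dots,\mu_N$ with weights $\lambda_1,\dots,\lambda_N$, that is, the minimizer of $\nu\mapsto\sum_{i=1}^N\lambda_iW_p^p(\mu_i,\nu)$ over the probability measures on $\mathbb{R}^d$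 with finite $p$-th moment, exists, is unique and has a density $g_p$ with respect to Lebesgue measure, and for every $q\in[1,\infty]$ $$g_p\in L^q(\mathbb{R}^d)\iff q<\frac{p-1}{p-2}.$$ (2) Suppose $1<p<2$ and that $\hat x_i\in\mathrm{bar}_p(B)$ and $\hat x_i\neq\overline{z}_p$ for some $i\in\{2,\dots,N\}$. Then the $p$-Wasserstein barycenter exists, is unique and has a density $g_p$, and for every $q\in[1,\infty]$ $$g_p\in L^q(\mathbb{R}^d)\iff q<\frac{1}{2-p}.$$ (3) Consequently, $L^q$-regularity of barycenters fails even for bounded, compactly supported marginals: for all $d\ge 1$, $N>2$, $p\in(1,\infty)\setminus\{2\}$ and all weights as above there are a bounded open set $B$ of measure $1$, points $\hat x_2,\dots,\hat x_N$ and an exponent $q\in(1,\infty)$ such that the $p$-Wasserstein barycenter of $\mathbf{1}_B\,dx,\delta_{\hat x_2},\dots,\delta_{\hat x_N}$ exists, is unique and has a density that is not in $L^q(\mathbb{R}^d)$. -/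

import Mathlib

open MeasureTheory
open scoped ENNReal

/-- The couplings (transport plans) of `μ` and `ν`. -/
def Coupling {d : ℕ} (μ ν : Measure (EuclideanSpace ℝ (Fin d))) :
    Set (Measure (EuclideanSpace ℝ (Fin d) × EuclideanSpace ℝ (Fin d))) :=
  {γ | γ.fst = μ ∧ γ.snd = ν}

/-- The `p`-Wasserstein distance `W_p(μ, ν)` on Euclidean space, with values in `[0, ∞]`. -/
noncomputable def wassersteinDist {d : ℕ} (p : ℝ)
    (μ ν : Measure (EuclideanSpace ℝ (Fin d))) : ℝ≥0∞ :=
  (⨅ γ ∈ Coupling μ ν, ∫⁻ y, ENNReal.ofReal (‖y.1 - y.2‖ ^ p) ∂γ) ^ (1 / p)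

/-- Membership in `P_p(ℝ^d)`: Borel probability measures with finite `p`-th moment. -/
def IsProbWithMoment {d : ℕ} (p : ℝ) (ν : Measure (EuclideanSpace ℝ (Fin d))) : Prop :=
  IsProbabilityMeasure ν ∧ ∫⁻ y, ENNReal.ofReal (‖y‖ ^ p) ∂ν < ∞

/-- The functional `ν ↦ ∑ i, w i * W_p(μ i, ν) ^ p`. -/
noncomputable def wassersteinBarycenterFunctional {d N : ℕ} (p : ℝ) (w : Fin N → ℝ)
    (μ : Fin N → Measure (EuclideanSpace ℝ (Fin d)))
    (ν : Measure (EuclideanSpace ℝ (Fin d))) : ℝ≥0∞ :=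
  ∑ i, ENNReal.ofReal (w i) * wassersteinDist p (μ i) ν ^ p

/-- `ν` is a `p`-Wasserstein barycenter of the measures `μ i` with weights `w i`. -/
def IsWassersteinBarycenter {d N : ℕ} (p : ℝ) (w : Fin N → ℝ)
    (μ : Fin N → Measure (EuclideanSpace ℝ (Fin d)))
    (ν : Measure (EuclideanSpace ℝ (Fin d))) : Prop :=
  IsProbWithMoment p ν ∧ ∀ ν', IsProbWithMoment p ν' →
    wassersteinBarycenterFunctional p w μ ν ≤ wassersteinBarycenterFunctional p w μ ν'

/-- The `p`-Wasserstein barycenter exists, is unique, and is absolutely continuous with respect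
to Lebesgue measure with density `g`. -/
def IsBarycenterDensity {d N : ℕ} (p : ℝ) (w : Fin N → ℝ)
    (μ : Fin N → Measure (EuclideanSpace ℝ (Fin d)))
    (g : EuclideanSpace ℝ (Fin d) → ℝ) : Prop :=
  Measurable g ∧ (∀ z, 0 ≤ g z) ∧
    ∀ ν, IsWassersteinBarycenter p w μ ν ↔
      ν = (volume : Measure (EuclideanSpace ℝ (Fin d))).withDensity
        (fun z => ENNReal.ofReal (g z))

/-- `z` is the `p`-barycenter of the points `x i` with weights `w i`, that is, it minimizes
`z ↦ ∑ i, w i * ‖x i - z‖ ^ p` (for `1 < p` and positive weights the minimizer is unique). -/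
def IsPointBarycenter {d N : ℕ} (p : ℝ) (w : Fin N → ℝ)
    (x : Fin N → EuclideanSpace ℝ (Fin d)) (z : EuclideanSpace ℝ (Fin d)) : Prop :=
  ∀ z', ∑ i, w i * ‖x i - z‖ ^ p ≤ ∑ i, w i * ‖x i - z'‖ ^ p

/-- The marginals: the first one is Lebesgue measure on `B`, the others are Dirac masses. -/
noncomputable def uniformAndDiracs {d n : ℕ} (B : Set (EuclideanSpace ℝ (Fin d)))
    (xhat : Fin n → EuclideanSpace ℝ (Fin d)) :
    Fin (n + 1) → Measure (EuclideanSpace ℝ (Fin d)) :=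
  Fin.cons (volume.restrict B) (fun i => Measure.dirac (xhat i))

/-! Write `a i` for the Dirac points and F(z) = ∑ w_i |z - a_i|^(p-2) (z - a_i) for their
`powField`. The objective is strictly convex, so z is the p-barycenter of (x, a) exactly when w₀ |x
- z|^(p-2) (x - z) = F(z). A radial power map is inverted by another radial power map, so x is
explicit: x = S(z) = z + P(F(z)/w₀) with P(v) = |v|^(1/(p-1)-1) v (`invBarycenter`). Existence and
uniqueness of point barycenters make S a continuous bijection; its inverse T is `barycenterMap`.

Only one marginal is not a Dirac mass, so the functional at ν is an infimum, over couplings of μ₁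
and ν, of the integrated point cost. Pointwise minimization shows that the pushforward of μ₁ under T
is optimal. It is the only optimum because leaving the graph of T by ε costs a uniform positive
amount (`exists_pointCost_gap`). Change of variables gives the density |det DS| on S⁻¹(B).

The exponents come from DS = I + DP(F/w₀) ∘ DF/w₀. If p > 2, DF is locally bounded and DP blows up
at the zero z̄ of F; since F vanishes there to exactly first order, DS has size |z - z̄|^(-β) with β
= (p-2)/(p-1). If p < 2, DP is locally bounded and DF blows up at each a_i like |z - a_i|^(-β) with
β = 2 - p; this survives in DS when F(a_i) ≠ 0, that is, a_i ≠ z̄. The blow-up is of the same order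
in every direction, so the determinant behaves like distance^(-dβ), and its q-th power is integrable
iff q < 1/β. -/

open Filter Topology

/-! ### Radial power maps: inverses, derivatives and convexity estimates -/

section PowMap

variable {E : Type*} [NormedAddCommGroup E] [InnerProductSpace ℝ E]

/-- The radial power map `x ↦ ‖x‖ ^ r • x`. -/
noncomputable def powMap (r : ℝ) (x : E) : E := ‖x‖ ^ r • x

/-- The derivative of `powMap r`, away from the origin if `r ≤ 0`. -/
noncomputable def powMapDeriv (r : ℝ) (x : E) : E →L[ℝ] E :=
  ‖x‖ ^ r • ContinuousLinearMap.id ℝ E + (r * ‖x‖ ^ (r - 2)) • (innerSL ℝ x).smulRight x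

@[simp] lemma powMap_zero (r : ℝ) : powMap r (0 : E) = 0 := by simp [powMap]

lemma norm_powMap {r : ℝ} (hr : -1 < r) (x : E) : ‖powMap r x‖ = ‖x‖ ^ (r + 1) := by
  rcases eq_or_ne x 0 with rfl | hx
  · simp [Real.zero_rpow (by linarith : r + 1 ≠ 0)]
  · have := norm_pos_iff.2 hx
    rw [powMap, norm_smul, Real.norm_of_nonneg (by positivity), Real.rpow_add_one this.ne']

lemma powMap_neg (r : ℝ) (x : E) : powMap r (-x) = -powMap r x := by simp [powMap]

/-- Radial maps compose by multiplying the exponents r + 1 and s + 1 of the norm. With r = p - 2 and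
s = 1/(p-1) - 1 this inverts the gradient of |·|^p / p. -/
lemma powMap_powMap {r s : ℝ} (hr : -1 < r) (h : (r + 1) * (s + 1) = 1) (x : E) :
    powMap s (powMap r x) = x := by
  rcases eq_or_ne x 0 with rfl | hx
  · simp
  · have hx' := norm_pos_iff.2 hx
    rw [powMap, norm_powMap hr, powMap, smul_smul, ← Real.rpow_mul hx'.le, ← Real.rpow_add hx',
      show (r + 1) * s + r = 0 by linarith, Real.rpow_zero, one_smul]

lemma continuous_powMap {r : ℝ} (hr : -1 < r) : Continuous (powMap r : E → E) := by
  rw [continuous_iff_continuousAt]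
  intro x
  rcases eq_or_ne x 0 with rfl | hx
  · rw [ContinuousAt, powMap_zero, tendsto_zero_iff_norm_tendsto_zero]
    simp only [norm_powMap hr]
    have : Tendsto (fun x : E => ‖x‖ ^ (r + 1)) (𝓝 0) (𝓝 (‖(0 : E)‖ ^ (r + 1))) :=
      continuous_norm.continuousAt.rpow_const (Or.inr (by linarith))
    simpa [Real.zero_rpow (by linarith : r + 1 ≠ 0)] using this
  · exact (continuous_norm.continuousAt.rpow_const (Or.inl (norm_ne_zero_iff.2 hx))).smul
      continuousAt_id

lemma hasFDerivAt_powMap {r : ℝ} {x : E} (h : x ≠ 0 ∨ 0 < r) :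
    HasFDerivAt (powMap r) (powMapDeriv r x) x := by
  rcases eq_or_ne x 0 with rfl | hx
  · have hr : 0 < r := h.resolve_left (by simp)
    have h0 : powMapDeriv r (0 : E) = 0 := by
      simp [powMapDeriv, Real.zero_rpow hr.ne']
    rw [h0, hasFDerivAt_iff_isLittleO_nhds_zero]
    simp only [zero_add, powMap_zero, sub_zero, zero_apply]
    have hT : Tendsto (fun x : E => ‖x‖ ^ r) (𝓝 0) (𝓝 0) := by
      have : Tendsto (fun x : E => ‖x‖ ^ r) (𝓝 0) (𝓝 (‖(0 : E)‖ ^ r)) :=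
        continuous_norm.continuousAt.rpow_const (Or.inr hr.le)
      simpa [Real.zero_rpow hr.ne'] using this
    have := ((Asymptotics.isLittleO_one_iff ℝ).2 hT).smul_isBigO
      (Asymptotics.isBigO_refl (fun x : E => x) (𝓝 0))
    simpa [powMap] using this
  · have hx' := norm_pos_iff.2 hx
    have h1 : HasFDerivAt (fun y : E => (‖y‖ ^ 2) ^ (r / 2)) _ x :=
      ((hasFDerivAt_id x).norm_sq).rpow_const (p := r / 2) (Or.inl (by simpa using hx))
    have h2 : (fun y : E => (‖y‖ ^ 2) ^ (r / 2)) = fun y => ‖y‖ ^ r := by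
      ext y
      rw [← Real.rpow_natCast, ← Real.rpow_mul (norm_nonneg _)]
      congr 1
      push_cast
      ring
    rw [h2] at h1
    refine (h1.smul (hasFDerivAt_id x)).congr_fderiv ?_
    ext1 y
    have h3 : (‖x‖ ^ 2) ^ (r / 2 - 1) = ‖x‖ ^ (r - 2) := by
      rw [← Real.rpow_natCast, ← Real.rpow_mul (norm_nonneg _)]
      congr 1
      push_cast
      ring
    simp only [powMapDeriv, add_apply, smul_apply,
      ContinuousLinearMap.id_apply, ContinuousLinearMap.smulRight_apply, innerSL_apply_apply, id,
      h3, ContinuousLinearMap.coe_comp, Function.comp_apply, smul_smul, nsmul_eq_mul,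
      smul_eq_mul]
    congr 2
    push_cast
    ring

lemma rpow_sub_two_mul_sq_le {r t : ℝ} (ht : 0 ≤ t) : t ^ (r - 2) * t ^ 2 ≤ t ^ r := by
  rcases ht.eq_or_lt with rfl | ht
  · simpa using Real.zero_rpow_nonneg r
  · rw [← Real.rpow_natCast t 2, ← Real.rpow_add ht]
    simp

lemma norm_powMapDeriv_le (r : ℝ) (x : E) : ‖powMapDeriv r x‖ ≤ (1 + |r|) * ‖x‖ ^ r := by
  have h0 : 0 ≤ ‖x‖ ^ r := by positivity
  have h1 : ‖‖x‖ ^ r • ContinuousLinearMap.id ℝ E‖ ≤ ‖x‖ ^ r := by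
    rw [norm_smul, Real.norm_of_nonneg h0]
    exact mul_le_of_le_one_right h0 ContinuousLinearMap.norm_id_le
  have h2 : ‖(r * ‖x‖ ^ (r - 2)) • (innerSL ℝ x).smulRight x‖ ≤ |r| * ‖x‖ ^ r := by
    rw [norm_smul, ContinuousLinearMap.norm_smulRight_apply, innerSL_apply_norm, norm_mul,
      Real.norm_eq_abs r, Real.norm_of_nonneg (by positivity : 0 ≤ ‖x‖ ^ (r - 2)), mul_assoc]
    have := rpow_sub_two_mul_sq_le (r := r) (norm_nonneg x)
    rw [sq] at this
    gcongr
  calc _ ≤ _ := norm_add_le _ _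
    _ ≤ ‖x‖ ^ r + |r| * ‖x‖ ^ r := add_le_add h1 h2
    _ = _ := by ring

/-- For x ≠ 0 the derivative has eigenvalue (1 + r)|x|^r along x and |x|^r on the orthogonal
complement. The quadratic form is bounded, rather than the norm, because such lower bounds add up
over positive combinations. -/
lemma le_inner_powMapDeriv (r : ℝ) (x y : E) :
    min 1 (1 + r) * ‖x‖ ^ r * ‖y‖ ^ 2 ≤ inner ℝ (powMapDeriv r x y) y := by
  have h0 : 0 ≤ ‖x‖ ^ r := by positivity
  have h1 : 0 ≤ ‖x‖ ^ (r - 2) := by positivity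
  have hcs : (inner ℝ x y) ^ 2 ≤ ‖x‖ ^ 2 * ‖y‖ ^ 2 := by
    rw [← mul_pow]
    exact sq_le_sq' (by linarith [neg_le_of_abs_le (abs_real_inner_le_norm x y)])
      (real_inner_le_norm x y)
  have h2 : ‖x‖ ^ (r - 2) * (inner ℝ x y) ^ 2 ≤ ‖x‖ ^ r * ‖y‖ ^ 2 := by
    calc _ ≤ ‖x‖ ^ (r - 2) * (‖x‖ ^ 2 * ‖y‖ ^ 2) := by gcongr
      _ = (‖x‖ ^ (r - 2) * ‖x‖ ^ 2) * ‖y‖ ^ 2 := by ring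
      _ ≤ _ := by gcongr; exact rpow_sub_two_mul_sq_le (norm_nonneg x)
  have h3 : inner ℝ (powMapDeriv r x y) y
      = ‖x‖ ^ r * ‖y‖ ^ 2 + r * (‖x‖ ^ (r - 2) * (inner ℝ x y) ^ 2) := by
    simp only [powMapDeriv, add_apply, smul_apply,
      ContinuousLinearMap.id_apply, ContinuousLinearMap.smulRight_apply, innerSL_apply_apply,
      inner_add_left, real_inner_smul_left, real_inner_self_eq_norm_sq]
    ring
  rw [h3]
  have h4 : 0 ≤ ‖x‖ ^ r * ‖y‖ ^ 2 := by positivity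
  have h5 : 0 ≤ ‖x‖ ^ (r - 2) * (inner ℝ x y) ^ 2 := by positivity
  rcases le_total 0 r with hr | hr
  · rw [min_eq_left (by linarith)]
    nlinarith
  · rw [min_eq_right (by linarith)]
    nlinarith

lemma le_norm_powMapDeriv_apply (r : ℝ) (x y : E) :
    min 1 (1 + r) * ‖x‖ ^ r * ‖y‖ ≤ ‖powMapDeriv r x y‖ := by
  rcases eq_or_ne y 0 with rfl | hy
  · simp
  · have := (le_inner_powMapDeriv r x y).trans (real_inner_le_norm _ _)
    refine le_of_mul_le_mul_right ?_ (norm_pos_iff.2 hy)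
    linarith [this]

/-- The strict gradient inequality for |·|^p. Cauchy–Schwarz reduces it to Bernoulli's inequality
for t = ‖y‖ / ‖x‖; when t = 1 Bernoulli is an equality and strictness comes from Cauchy–Schwarz
instead. -/
lemma norm_rpow_add_inner_lt {p : ℝ} (hp : 1 < p) {x y : E} (h : y ≠ x) :
    ‖x‖ ^ p + p * inner ℝ (powMap (p - 2) x) (y - x) < ‖y‖ ^ p := by
  rcases eq_or_ne x 0 with rfl | hx
  · have := norm_pos_iff.2 h
    simpa [Real.zero_rpow (by linarith : p ≠ 0)] using Real.rpow_pos_of_pos this p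
  have hx' := norm_pos_iff.2 hx
  have hxp : 0 < ‖x‖ ^ p := by positivity
  have e1 : inner ℝ (powMap (p - 2) x) (y - x) = ‖x‖ ^ (p - 2) * (inner ℝ x y - ‖x‖ ^ 2) := by
    rw [powMap, real_inner_smul_left, inner_sub_right, real_inner_self_eq_norm_sq]
  have e2 : ‖x‖ ^ p = ‖x‖ ^ (p - 2) * ‖x‖ ^ 2 := by
    rw [← Real.rpow_natCast ‖x‖ 2, ← Real.rpow_add hx']
    simp
  have hpos : 0 < ‖x‖ ^ (p - 2) := by positivity
  have hcs := real_inner_le_norm x y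
  set t : ℝ := ‖y‖ / ‖x‖ with ht
  have hy : ‖y‖ = t * ‖x‖ := by rw [ht]; field_simp
  have ht0 : 0 ≤ t := by positivity
  have e3 : ‖y‖ ^ p = t ^ p * ‖x‖ ^ p := by rw [hy, Real.mul_rpow ht0 hx'.le]
  rcases eq_or_ne t 1 with h1 | h1
  · have hn : ‖y‖ = ‖x‖ := by rw [hy, h1, one_mul]
    have hlt : inner ℝ x y < ‖x‖ ^ 2 := by
      have : 0 < ‖y - x‖ ^ 2 := by
        have := norm_pos_iff.2 (sub_ne_zero.2 h)
        positivity
      rw [norm_sub_sq_real, hn, real_inner_comm] at this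
      linarith
    rw [e1, hn]
    have : p * (‖x‖ ^ (p - 2) * (inner ℝ x y - ‖x‖ ^ 2)) < 0 := by
      apply mul_neg_of_pos_of_neg (by linarith)
      exact mul_neg_of_pos_of_neg hpos (by linarith)
    linarith
  · have hb := one_add_mul_self_lt_rpow_one_add (s := t - 1) (by linarith) (sub_ne_zero.2 h1) hp
    rw [add_sub_cancel] at hb
    rw [e1, e3]
    have h2 : inner ℝ x y - ‖x‖ ^ 2 ≤ (t - 1) * ‖x‖ ^ 2 := by
      rw [hy] at hcs
      nlinarith
    calc ‖x‖ ^ p + p * (‖x‖ ^ (p - 2) * (inner ℝ x y - ‖x‖ ^ 2))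
        ≤ ‖x‖ ^ p + p * (‖x‖ ^ (p - 2) * ((t - 1) * ‖x‖ ^ 2)) := by gcongr
      _ = (1 + p * (t - 1)) * ‖x‖ ^ p := by rw [e2]; ring
      _ < t ^ p * ‖x‖ ^ p := by gcongr

/-- The inner product splits into a symmetric quadratic term and a product of two differences that
have the same sign, by monotonicity of powers. -/
lemma le_inner_powMap_sub {r : ℝ} (hr : 0 ≤ r) (x y : E) :
    ‖y‖ ^ r / 2 * ‖x - y‖ ^ 2 ≤ inner ℝ (powMap r x - powMap r y) (x - y) := by
  have e : inner ℝ (powMap r x - powMap r y) (x - y)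
      = (‖x‖ ^ r + ‖y‖ ^ r) / 2 * ‖x - y‖ ^ 2
        + (‖x‖ ^ r - ‖y‖ ^ r) * (‖x‖ ^ 2 - ‖y‖ ^ 2) / 2 := by
    simp only [powMap, inner_sub_left, inner_sub_right, real_inner_smul_left,
      real_inner_self_eq_norm_sq, norm_sub_sq_real, real_inner_comm x y]
    ring
  have h1 : 0 ≤ (‖x‖ ^ r - ‖y‖ ^ r) * (‖x‖ ^ 2 - ‖y‖ ^ 2) := by
    rcases le_total ‖x‖ ‖y‖ with h | h
    · exact mul_nonneg_of_nonpos_of_nonpos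
        (sub_nonpos.2 (Real.rpow_le_rpow (norm_nonneg _) h hr)) (sub_nonpos.2 (by gcongr))
    · exact mul_nonneg
        (sub_nonneg.2 (Real.rpow_le_rpow (norm_nonneg _) h hr)) (sub_nonneg.2 (by gcongr))
  have h2 : 0 ≤ ‖x‖ ^ r * ‖x - y‖ ^ 2 := by positivity
  rw [e]
  linarith

end PowMap

/-! ### Barycenters of points and the inverse barycenter map -/

section PointBarycenter

variable {d N n : ℕ}

local notation "𝔼" d => EuclideanSpace ℝ (Fin d)

/-- The objective minimized by the `p`-barycenter of points. -/
noncomputable def pointCost (p : ℝ) (w : Fin N → ℝ) (x : Fin N → 𝔼 d) (z : 𝔼 d) : ℝ :=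
  ∑ i, w i * ‖x i - z‖ ^ p

/-- The vector field `z ↦ ∑ i, w i • ‖z - x i‖ ^ r • (z - x i)`. -/
noncomputable def powField (r : ℝ) (w : Fin N → ℝ) (x : Fin N → 𝔼 d) (z : 𝔼 d) : 𝔼 d :=
  ∑ i, w i • powMap r (z - x i)

/-- The map sending `z` to the only `x` such that `z` is the `p`-barycenter of `x` and the `a i`. -/
noncomputable def invBarycenter (p w₀ : ℝ) (c : Fin n → ℝ) (a : Fin n → 𝔼 d) (z : 𝔼 d) : 𝔼 d :=
  z + powMap (1 / (p - 1) - 1) (w₀⁻¹ • powField (p - 2) c a z)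

variable {p : ℝ} {w : Fin N → ℝ} {x : Fin N → 𝔼 d} {z : 𝔼 d}

lemma isPointBarycenter_def :
    IsPointBarycenter p w x z ↔ ∀ z', pointCost p w x z ≤ pointCost p w x z' := Iff.rfl

lemma continuous_powField {r : ℝ} (hr : -1 < r) : Continuous (powField r w x) :=
  continuous_finsetSum _ fun i _ =>
    ((continuous_powMap hr).comp (continuous_id.sub continuous_const)).const_smul (w i)

lemma continuous_pointCost (hp : 1 < p) : Continuous (pointCost p w x) :=
  continuous_finsetSum _ fun i _ => continuous_const.mul
    ((continuous_const.sub continuous_id).norm.rpow_const fun _ => Or.inr (by linarith))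

lemma pointCost_add_inner_le (hp : 1 < p) (hw : ∀ i, 0 < w i) (z y : 𝔼 d) :
    pointCost p w x z + p * inner ℝ (powField (p - 2) w x z) (y - z) ≤ pointCost p w x y := by
  have h : ∀ i, ‖x i - z‖ ^ p + p * inner ℝ (powMap (p - 2) (z - x i)) (y - z)
      ≤ ‖x i - y‖ ^ p := by
    intro i
    rcases eq_or_ne y z with rfl | hyz
    · simp
    · have := norm_rpow_add_inner_lt hp (x := z - x i) (y := y - x i) (by simpa using hyz)
      rw [norm_sub_rev (x i) z, norm_sub_rev (x i) y]
      simpa using this.le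
  simp only [pointCost, powField, sum_inner, real_inner_smul_left, Finset.mul_sum]
  rw [← Finset.sum_add_distrib]
  refine Finset.sum_le_sum fun i _ => ?_
  have := mul_le_mul_of_nonneg_left (h i) (hw i).le
  linarith

lemma pointCost_add_inner_lt (hp : 1 < p) (hw : ∀ i, 0 < w i) (hN : 0 < N) {z y : 𝔼 d}
    (hyz : y ≠ z) :
    pointCost p w x z + p * inner ℝ (powField (p - 2) w x z) (y - z) < pointCost p w x y := by
  have h : ∀ i, ‖x i - z‖ ^ p + p * inner ℝ (powMap (p - 2) (z - x i)) (y - z)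
      < ‖x i - y‖ ^ p := by
    intro i
    have := norm_rpow_add_inner_lt hp (x := z - x i) (y := y - x i) (by simpa using hyz)
    rw [norm_sub_rev (x i) z, norm_sub_rev (x i) y]
    simpa using this
  simp only [pointCost, powField, sum_inner, real_inner_smul_left, Finset.mul_sum]
  rw [← Finset.sum_add_distrib]
  have : Nonempty (Fin N) := ⟨⟨0, hN⟩⟩
  refine Finset.sum_lt_sum_of_nonempty Finset.univ_nonempty fun i _ => ?_
  have := mul_lt_mul_of_pos_left (h i) (hw i)
  linarith

lemma hasFDerivAt_pointCost (hp : 1 < p) (z : 𝔼 d) :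
    HasFDerivAt (pointCost p w x) (p • innerSL ℝ (powField (p - 2) w x z)) z := by
  have h : ∀ i ∈ (Finset.univ : Finset (Fin N)), HasFDerivAt (fun z => w i * ‖x i - z‖ ^ p)
      (w i • ((p * ‖z - x i‖ ^ (p - 2)) • innerSL ℝ (z - x i))) z := by
    intro i _
    have h1 := (hasFDerivAt_norm_rpow (z - x i) hp).comp z ((hasFDerivAt_id z).sub_const (x i))
    have h2 := h1.const_mul (w i)
    simp only [Function.comp_def, id, norm_sub_rev _ (x i)] at h2
    refine h2.congr_fderiv ?_
    rw [norm_sub_rev z]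
    rfl
  refine (HasFDerivAt.fun_sum h).congr_fderiv ?_
  ext y
  simp only [powField, powMap, sum_apply, smul_apply, innerSL_apply_apply,
    sum_inner, real_inner_smul_left, smul_eq_mul, Finset.mul_sum]
  exact Finset.sum_congr rfl fun i _ => by ring

lemma isPointBarycenter_iff (hp : 1 < p) (hw : ∀ i, 0 < w i) :
    IsPointBarycenter p w x z ↔ powField (p - 2) w x z = 0 := by
  rw [isPointBarycenter_def]
  constructor
  · intro h
    have h1 : IsLocalMin (pointCost p w x) z := Eventually.of_forall h
    have h2 := h1.hasFDerivAt_eq_zero (hasFDerivAt_pointCost hp z)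
    have h3 := congrArg (fun L => L (powField (p - 2) w x z)) h2
    simp only [smul_apply, innerSL_apply_apply, real_inner_self_eq_norm_sq, smul_eq_mul,
      zero_apply] at h3
    have : p ≠ 0 := by linarith
    simpa [this] using h3
  · intro h z'
    simpa [h] using pointCost_add_inner_le (x := x) hp hw z z'

lemma pointCost_lt_of_powField_eq_zero (hp : 1 < p) (hw : ∀ i, 0 < w i) (hN : 0 < N)
    (h : powField (p - 2) w x z = 0) {y : 𝔼 d} (hyz : y ≠ z) :
    pointCost p w x z < pointCost p w x y := by
  simpa [h] using pointCost_add_inner_lt (x := x) hp hw hN hyz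

lemma le_pointCost (hw : ∀ i, 0 < w i) (i : Fin N) :
    w i * ‖x i - z‖ ^ p ≤ pointCost p w x z :=
  Finset.single_le_sum (f := fun i => w i * ‖x i - z‖ ^ p)
    (fun j _ => mul_nonneg (hw j).le (by positivity)) (Finset.mem_univ i)

lemma pointCost_nonneg (hw : ∀ i, 0 < w i) : 0 ≤ pointCost p w x z :=
  Finset.sum_nonneg fun j _ => mul_nonneg (hw j).le (by positivity)

lemma exists_isPointBarycenter (hp : 1 < p) (hw : ∀ i, 0 < w i) (hN : 0 < N) :
    ∃ z, IsPointBarycenter p w x z := by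
  refine (continuous_pointCost hp).exists_forall_le ?_
  have h1 : Tendsto (fun z : 𝔼 d => ‖x ⟨0, hN⟩ - z‖) (cocompact _) atTop := by
    have := tendsto_norm_cocompact_atTop.comp
      (Homeomorph.subLeft (x ⟨0, hN⟩)).isClosedEmbedding.tendsto_cocompact
    simpa [Function.comp_def] using this
  have h2 := ((tendsto_rpow_atTop (by linarith : 0 < p)).comp h1).const_mul_atTop (hw ⟨0, hN⟩)
  exact tendsto_atTop_mono (fun z => le_pointCost hw ⟨0, hN⟩) h2

/-- The tuple consisting of `x` followed by the `a i`. -/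
abbrev consPoint (x : 𝔼 d) (a : Fin n → 𝔼 d) : Fin (n + 1) → 𝔼 d := Fin.cons x a

variable {w : Fin (n + 1) → ℝ} {a : Fin n → 𝔼 d}

lemma powField_cons (r : ℝ) (x z : 𝔼 d) :
    powField r w (consPoint x a) z
      = w 0 • powMap r (z - x) + powField r (fun i => w i.succ) a z := by
  simp [powField, Fin.sum_univ_succ]

/-- The new point x enters the first-order condition through a single power map, which can be
inverted; hence x is an explicit function of z. -/
lemma powField_cons_eq_zero_iff (hp : 1 < p) (hw : ∀ i, 0 < w i) {x z : 𝔼 d} :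
    powField (p - 2) w (consPoint x a) z = 0
      ↔ invBarycenter p (w 0) (fun i => w i.succ) a z = x := by
  have hw0 := (hw 0).ne'
  have h1 : -1 < p - 2 := by linarith
  have h1' : p - 1 ≠ 0 := by linarith
  have h2 : -1 < 1 / (p - 1) - 1 := by
    have : 0 < 1 / (p - 1) := by apply one_div_pos.2; linarith
    linarith
  have h3 : (p - 2 + 1) * (1 / (p - 1) - 1 + 1) = 1 := by
    field_simp
    ring
  rw [powField_cons, invBarycenter, ← neg_sub x z, powMap_neg, smul_neg, neg_add_eq_zero]
  constructor
  · intro h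
    rw [← h, inv_smul_smul₀ hw0, powMap_powMap h1 h3]
    simp
  · intro h
    rw [← h, add_sub_cancel_left, powMap_powMap h2 (by rw [mul_comm]; exact h3),
      smul_inv_smul₀ hw0]

lemma isPointBarycenter_cons_iff (hp : 1 < p) (hw : ∀ i, 0 < w i) {x z : 𝔼 d} :
    IsPointBarycenter p w (consPoint x a) z
      ↔ invBarycenter p (w 0) (fun i => w i.succ) a z = x := by
  rw [isPointBarycenter_iff hp hw, powField_cons_eq_zero_iff hp hw]

lemma continuous_invBarycenter (hp : 1 < p) (w₀ : ℝ) (c : Fin n → ℝ) :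
    Continuous (invBarycenter p w₀ c a) := by
  have h2 : -1 < 1 / (p - 1) - 1 := by
    have : 0 < 1 / (p - 1) := by apply one_div_pos.2; linarith
    linarith
  exact continuous_id.add ((continuous_powMap h2).comp
    ((continuous_powField (by linarith : -1 < p - 2)).const_smul w₀⁻¹))

/-- Injectivity is uniqueness of the barycenter of (x, a), surjectivity is its existence. -/
lemma bijective_invBarycenter (hp : 1 < p) (hw : ∀ i, 0 < w i) :
    Function.Bijective (invBarycenter p (w 0) (fun i => w i.succ) a) := by
  constructor
  · intro z y h
    by_contra hne
    have h1 := (powField_cons_eq_zero_iff (a := a) hp hw).2 h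
    have h2 := (powField_cons_eq_zero_iff (a := a) hp hw).2
      (rfl : invBarycenter p (w 0) (fun i => w i.succ) a y = _)
    have h3 := pointCost_lt_of_powField_eq_zero hp hw n.succ_pos h1 (Ne.symm hne)
    have h4 := pointCost_lt_of_powField_eq_zero hp hw n.succ_pos h2 hne
    exact lt_asymm h3 h4
  · intro x
    obtain ⟨z, hz⟩ := exists_isPointBarycenter (x := consPoint x a) hp hw n.succ_pos
    exact ⟨z, (isPointBarycenter_cons_iff hp hw).1 hz⟩

lemma continuous_pointCost_cons (hp : 1 < p) (w : Fin (n + 1) → ℝ) (a : Fin n → 𝔼 d)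
    {X : Type*} [TopologicalSpace X] {f g : X → 𝔼 d} (hf : Continuous f) (hg : Continuous g) :
    Continuous fun t => pointCost p w (consPoint (f t) a) (g t) := by
  have h0 : 0 ≤ p := by linarith
  simp only [pointCost, consPoint, Fin.sum_univ_succ, Fin.cons_zero, Fin.cons_succ]
  refine (continuous_const.mul ((hf.sub hg).norm.rpow_const fun _ => Or.inr h0)).add ?_
  exact continuous_finsetSum _ fun i _ => continuous_const.mul
    ((continuous_const.sub hg).norm.rpow_const fun _ => Or.inr h0)

lemma isBounded_preimage_invBarycenter (hp : 1 < p) (hw : ∀ i, 0 < w i) {B : Set (𝔼 d)}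
    (hB : Bornology.IsBounded B) :
    Bornology.IsBounded (invBarycenter p (w 0) (fun i => w i.succ) a ⁻¹' B) := by
  obtain ⟨R, hR⟩ := hB.exists_norm_le
  have hc : Continuous fun x : 𝔼 d => pointCost p w (consPoint x a) x :=
    continuous_pointCost_cons hp w a continuous_id continuous_id
  obtain ⟨M, hM⟩ := (isCompact_closedBall (0 : 𝔼 d) R).bddAbove_image hc.continuousOn
  rw [isBounded_iff_forall_norm_le]
  refine ⟨R + (M / w 0) ^ (1 / p), fun z hz => ?_⟩
  set x := invBarycenter p (w 0) (fun i => w i.succ) a z with hx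
  have h1 := (isPointBarycenter_cons_iff (a := a) hp hw).2 hx.symm
  -- Comparing the minimizer z with the competitor x bounds |x - z| in terms of x alone.
  have h2 : w 0 * ‖x - z‖ ^ p ≤ M := by
    have h3 := le_pointCost (p := p) (x := (consPoint x a)) (z := z) hw 0
    have h4 := h1 x
    have h5 : pointCost p w (consPoint x a) x ≤ M :=
      hM ⟨x, by simpa using hR x hz, rfl⟩
    exact h3.trans (h4.trans h5)
  have h3 : ‖x - z‖ ≤ (M / w 0) ^ (1 / p) := by
    have h4 : 0 ≤ w 0 * ‖x - z‖ ^ p := mul_nonneg (hw 0).le (by positivity)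
    rw [one_div, Real.le_rpow_inv_iff_of_pos (norm_nonneg _)
      (div_nonneg (h4.trans h2) (hw 0).le) (by linarith), le_div_iff₀ (hw 0)]
    linarith
  calc ‖z‖ = ‖x - (x - z)‖ := by simp
    _ ≤ ‖x‖ + ‖x - z‖ := norm_sub_le _ _
    _ ≤ _ := add_le_add (hR x hz) h3

/-- Compactness gives a uniform gap on the sphere of radius ε about the minimizer, and convexity
propagates it outward. This quantifies strict minimality and drives uniqueness of the Wasserstein
barycenter. -/
lemma exists_pointCost_gap (hp : 1 < p) (hw : ∀ i, 0 < w i) {K : Set (𝔼 d)} (hK : IsCompact K)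
    {ε : ℝ} (hε : 0 < ε) :
    ∃ c > 0, ∀ z ∈ K, ∀ y, ε ≤ ‖y - z‖ →
      pointCost p w (consPoint (invBarycenter p (w 0) (fun i => w i.succ) a z) a) z + c
        ≤ pointCost p w (consPoint (invBarycenter p (w 0) (fun i => w i.succ) a z) a) y := by
  set S := invBarycenter p (w 0) (fun i => w i.succ) a
  have hS : Continuous S := continuous_invBarycenter hp _ _
  have hS0 : ∀ z, powField (p - 2) w (consPoint (S z) a) z = 0 := fun z =>
    (powField_cons_eq_zero_iff hp hw).2 rfl
  let φ : (𝔼 d) × (𝔼 d) → ℝ := fun q =>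
    pointCost p w (consPoint (S q.1) a) (q.1 + q.2) - pointCost p w (consPoint (S q.1) a) q.1
  have hφ : Continuous φ :=
    (continuous_pointCost_cons hp w a (hS.comp continuous_fst)
      (continuous_fst.add continuous_snd)).sub
    (continuous_pointCost_cons hp w a (hS.comp continuous_fst) continuous_fst)
  have hpos : ∀ q ∈ K ×ˢ Metric.sphere (0 : 𝔼 d) ε, 0 < φ q := by
    rintro ⟨z, e⟩ ⟨-, he⟩
    refine sub_pos.2 (pointCost_lt_of_powField_eq_zero hp hw n.succ_pos (hS0 z) ?_)
    have : e ≠ 0 := by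
      rintro rfl
      simp [hε.ne] at he
    simpa using this
  obtain ⟨c, hc, hcφ⟩ : ∃ c > 0, ∀ q ∈ K ×ˢ Metric.sphere (0 : 𝔼 d) ε, c ≤ φ q := by
    rcases (K ×ˢ Metric.sphere (0 : 𝔼 d) ε).eq_empty_or_nonempty with h | h
    · exact ⟨1, one_pos, by simp [h]⟩
    · obtain ⟨q, hq, hmin⟩ := (hK.prod (isCompact_sphere _ _)).exists_isMinOn h hφ.continuousOn
      exact ⟨φ q, hpos q hq, fun q' hq' => hmin hq'⟩
  refine ⟨c, hc, fun z hz y hy => ?_⟩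
  have hn : 0 < ‖y - z‖ := hε.trans_le hy
  set t := ε / ‖y - z‖ with ht
  have ht0 : 0 < t := by positivity
  have ht1 : t ≤ 1 := (div_le_one hn).2 hy
  set e := t • (y - z) with he
  have hen : ‖e‖ = ε := by
    rw [he, norm_smul, Real.norm_of_nonneg ht0.le, ht]
    field_simp
  have h1 : c ≤ φ (z, e) := hcφ _ ⟨hz, by simpa using hen⟩
  simp only [φ] at h1
  set G := powField (p - 2) w (consPoint (S z) a) (z + e)
  -- A supporting hyperplane at the sphere point z + e: since the cost at z is lower, its slope
  -- towards y is nonnegative, so the cost at y is at least that at z + e.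
  have h2 := pointCost_add_inner_le (x := consPoint (S z) a) hp hw (z + e) z
  have h3 := pointCost_add_inner_le (x := consPoint (S z) a) hp hw (z + e) y
  have e1 : z - (z + e) = -(t • (y - z)) := by rw [he]; abel
  have e2 : y - (z + e) = (1 - t) • (y - z) := by rw [he, sub_smul, one_smul]; abel
  rw [e1, inner_neg_right, real_inner_smul_right] at h2
  rw [e2, real_inner_smul_right] at h3
  have h4 : 0 ≤ t * (p * inner ℝ G (y - z)) := by linarith
  have h5 : 0 ≤ p * inner ℝ G (y - z) := nonneg_of_mul_nonneg_right h4 ht0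
  have h6 : 0 ≤ p * ((1 - t) * inner ℝ G (y - z)) := by
    rw [mul_left_comm]
    exact mul_nonneg (by linarith) h5
  linarith

end PointBarycenter

/-! ### The Wasserstein barycenter as a pushforward -/

section Transport

variable {d n : ℕ}

local notation "𝔼" d => EuclideanSpace ℝ (Fin d)

lemma wassersteinDist_rpow {p : ℝ} (hp : 0 < p) (μ ν : Measure (𝔼 d)) :
    wassersteinDist p μ ν ^ p
      = ⨅ γ ∈ Coupling μ ν, ∫⁻ y, ENNReal.ofReal (‖y.1 - y.2‖ ^ p) ∂γ := by
  rw [wassersteinDist, one_div, ENNReal.rpow_inv_rpow hp.ne']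

lemma measurable_ofReal_norm_rpow {X : Type*} [MeasurableSpace X] {f : X → 𝔼 d}
    (hf : Measurable f) (p : ℝ) : Measurable fun x => ENNReal.ofReal (‖f x‖ ^ p) :=
  (hf.norm.pow_const p).ennreal_ofReal

lemma wassersteinDist_dirac_rpow {p : ℝ} (hp : 0 < p) (x : 𝔼 d) (ν : Measure (𝔼 d))
    [IsProbabilityMeasure ν] :
    wassersteinDist p (Measure.dirac x) ν ^ p = ∫⁻ y, ENNReal.ofReal (‖x - y‖ ^ p) ∂ν := by
  rw [wassersteinDist_rpow hp]
  have key : ∀ γ ∈ Coupling (Measure.dirac x) ν,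
      ∫⁻ y, ENNReal.ofReal (‖y.1 - y.2‖ ^ p) ∂γ = ∫⁻ y, ENNReal.ofReal (‖x - y‖ ^ p) ∂ν := by
    rintro γ ⟨h1, h2⟩
    have hae : ∀ᵐ y ∂γ, y.1 = x := by
      have : ∀ᵐ y ∂γ.fst, y = x := by
        rw [h1]
        exact (ae_dirac_iff (measurableSet_singleton x)).2 rfl
      exact ae_of_ae_map measurable_fst.aemeasurable this
    have hm : Measurable fun y : 𝔼 d => ENNReal.ofReal (‖x - y‖ ^ p) :=
      measurable_ofReal_norm_rpow (measurable_const.sub measurable_id) p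
    rw [← h2, Measure.snd, lintegral_map hm measurable_snd]
    exact lintegral_congr_ae (hae.mono fun y hy => by simp only [hy])
  apply le_antisymm
  · have hmem : (Measure.dirac x).prod ν ∈ Coupling (Measure.dirac x) ν := by
      simp [Coupling]
    exact (iInf₂_le _ hmem).trans (key _ hmem).le
  · exact le_iInf₂ fun γ hγ => (key γ hγ).ge

lemma measurable_pointCost_cons (p : ℝ) (w : Fin (n + 1) → ℝ) (a : Fin n → 𝔼 d)
    {X : Type*} [MeasurableSpace X] {f g : X → 𝔼 d} (hf : Measurable f) (hg : Measurable g) :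
    Measurable fun t => pointCost p w (consPoint (f t) a) (g t) := by
  simp only [pointCost, consPoint, Fin.sum_univ_succ, Fin.cons_zero, Fin.cons_succ]
  refine (measurable_const.mul ((hf.sub hg).norm.pow_const p)).add ?_
  exact Finset.measurable_fun_sum _ fun i _ => measurable_const.mul
    ((measurable_const.sub hg).norm.pow_const p)

variable {p : ℝ} {w : Fin (n + 1) → ℝ} {a : Fin n → 𝔼 d} {B : Set (𝔼 d)}

lemma lintegral_pointCost_cons (hw : ∀ i, 0 < w i) (γ : Measure ((𝔼 d) × (𝔼 d))) :
    ∫⁻ q, ENNReal.ofReal (pointCost p w (consPoint q.1 a) q.2) ∂γ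
      = ENNReal.ofReal (w 0) * ∫⁻ q, ENNReal.ofReal (‖q.1 - q.2‖ ^ p) ∂γ
        + ∑ i : Fin n, ENNReal.ofReal (w i.succ)
          * ∫⁻ y, ENNReal.ofReal (‖a i - y‖ ^ p) ∂γ.snd := by
  have hm : ∀ i : Fin n, Measurable fun y : 𝔼 d => ENNReal.ofReal (‖a i - y‖ ^ p) := fun i =>
    measurable_ofReal_norm_rpow (measurable_const.sub measurable_id) p
  have h0 : Measurable fun q : (𝔼 d) × (𝔼 d) => ENNReal.ofReal (‖q.1 - q.2‖ ^ p) :=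
    measurable_ofReal_norm_rpow (measurable_fst.sub measurable_snd) p
  have hpt : ∀ q : (𝔼 d) × (𝔼 d), ENNReal.ofReal (pointCost p w (consPoint q.1 a) q.2)
      = ENNReal.ofReal (w 0) * ENNReal.ofReal (‖q.1 - q.2‖ ^ p)
        + ∑ i : Fin n, ENNReal.ofReal (w i.succ) * ENNReal.ofReal (‖a i - q.2‖ ^ p) := by
    intro q
    have hs : ∀ i : Fin n, 0 ≤ w i.succ * ‖a i - q.2‖ ^ p := fun i =>
      mul_nonneg (hw _).le (by positivity)
    simp only [pointCost, consPoint, Fin.sum_univ_succ, Fin.cons_zero, Fin.cons_succ]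
    rw [ENNReal.ofReal_add (mul_nonneg (hw _).le (by positivity))
      (Finset.sum_nonneg fun i _ => hs i), ENNReal.ofReal_sum_of_nonneg fun i _ => hs i,
      ENNReal.ofReal_mul (hw 0).le]
    simp only [ENNReal.ofReal_mul (hw _).le]
  simp only [hpt]
  rw [lintegral_add_left (h0.const_mul _), lintegral_const_mul _ h0, lintegral_finsetSum]
  · congr 1
    refine Finset.sum_congr rfl fun i _ => ?_
    have h1 : Measurable fun q : (𝔼 d) × (𝔼 d) => ENNReal.ofReal (‖a i - q.2‖ ^ p) :=
      (hm i).comp measurable_snd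
    rw [lintegral_const_mul _ h1, Measure.snd, lintegral_map (hm i) measurable_snd]
  · exact fun i _ => ((hm i).comp measurable_snd).const_mul _

/-- The Dirac terms depend on ν only, so they are the same for every coupling and move inside the
infimum. -/
lemma wassersteinBarycenterFunctional_uniformAndDiracs (hp : 0 < p) (hw : ∀ i, 0 < w i)
    (ν : Measure (𝔼 d)) [IsProbabilityMeasure ν] :
    wassersteinBarycenterFunctional p w (uniformAndDiracs B a) ν
      = ⨅ γ ∈ Coupling (volume.restrict B) ν,
          ∫⁻ q, ENNReal.ofReal (pointCost p w (consPoint q.1 a) q.2) ∂γ := by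
  simp only [wassersteinBarycenterFunctional, uniformAndDiracs, Fin.sum_univ_succ, Fin.cons_zero,
    Fin.cons_succ, wassersteinDist_dirac_rpow hp, wassersteinDist_rpow hp (volume.restrict B)]
  have h0 : ENNReal.ofReal (w 0) ≠ 0 := by simpa using hw 0
  simp only [ENNReal.mul_iInf_of_ne h0 ENNReal.ofReal_ne_top, ENNReal.iInf_add]
  refine iInf_congr fun γ => iInf_congr fun hγ => ?_
  rw [lintegral_pointCost_cons hw, hγ.2]

lemma eq_of_forall_isClosed_measure_le {X : Type*} [TopologicalSpace X]
    [TopologicalSpace.PseudoMetrizableSpace X] [MeasurableSpace X] [BorelSpace X]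
    {μ ν : Measure X} [IsProbabilityMeasure μ] [IsProbabilityMeasure ν]
    (h : ∀ F, IsClosed F → μ F ≤ ν F) : μ = ν := by
  refine Measure.eq_of_le_of_isProbabilityMeasure (Measure.le_iff.2 fun s hs => ?_)
  rw [hs.measure_eq_iSup_isClosed_of_ne_top (measure_ne_top μ s)]
  exact iSup₂_le fun F hF => iSup_le fun hc => (h F hc).trans (measure_mono hF)

variable (p w a) in
/-- The map sending `x` to the `p`-barycenter of `x` and the `a i`. -/
noncomputable def barycenterMap (x : 𝔼 d) : 𝔼 d :=
  Function.invFun (invBarycenter p (w 0) (fun i => w i.succ) a) x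

lemma invBarycenter_barycenterMap (hp : 1 < p) (hw : ∀ i, 0 < w i) (x : 𝔼 d) :
    invBarycenter p (w 0) (fun i => w i.succ) a (barycenterMap p w a x) = x :=
  Function.invFun_eq ((bijective_invBarycenter hp hw).2 x)

lemma preimage_barycenterMap (hp : 1 < p) (hw : ∀ i, 0 < w i) (s : Set (𝔼 d)) :
    barycenterMap p w a ⁻¹' s = invBarycenter p (w 0) (fun i => w i.succ) a '' s := by
  ext x
  constructor
  · exact fun h => ⟨_, h, invBarycenter_barycenterMap hp hw x⟩
  · rintro ⟨z, hz, rfl⟩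
    have := (bijective_invBarycenter (a := a) hp hw).1
      (invBarycenter_barycenterMap (a := a) hp hw
        (invBarycenter p (w 0) (fun i => w i.succ) a z))
    rwa [Set.mem_preimage, this]

/-- By Lusin–Souslin, a continuous injection maps Borel sets to Borel sets; continuity of the
inverse is not needed. -/
lemma measurable_barycenterMap (hp : 1 < p) (hw : ∀ i, 0 < w i) :
    Measurable (barycenterMap p w a) := by
  intro s hs
  rw [preimage_barycenterMap hp hw]
  exact ((continuous_invBarycenter hp _ _).measurableEmbedding
    (bijective_invBarycenter hp hw).1).measurableSet_image.2 hs

lemma pointCost_barycenterMap_le (hp : 1 < p) (hw : ∀ i, 0 < w i) (x y : 𝔼 d) :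
    pointCost p w (consPoint x a) (barycenterMap p w a x) ≤ pointCost p w (consPoint x a) y :=
  (isPointBarycenter_cons_iff hp hw).2 (invBarycenter_barycenterMap hp hw x) y

variable (p w a) in
/-- The cost of the optimal multi-marginal plan. -/
noncomputable def optimalCost (B : Set (𝔼 d)) : ℝ≥0∞ :=
  ∫⁻ x in B, ENNReal.ofReal (pointCost p w (consPoint x a) (barycenterMap p w a x))

lemma lintegral_fst_coupling (hp : 1 < p) (hw : ∀ i, 0 < w i) {ν : Measure (𝔼 d)}
    {γ : Measure ((𝔼 d) × (𝔼 d))} (hγ : γ ∈ Coupling (volume.restrict B) ν) :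
    ∫⁻ q, ENNReal.ofReal (pointCost p w (consPoint q.1 a) (barycenterMap p w a q.1)) ∂γ
      = optimalCost p w a B := by
  have hm := (measurable_pointCost_cons p w a measurable_id'
    (measurable_barycenterMap (a := a) hp hw)).ennreal_ofReal
  rw [optimalCost, ← hγ.1, Measure.fst, lintegral_map hm measurable_fst]

lemma optimalCost_le (hp : 1 < p) (hw : ∀ i, 0 < w i) (ν : Measure (𝔼 d))
    [IsProbabilityMeasure ν] :
    optimalCost p w a B ≤ wassersteinBarycenterFunctional p w (uniformAndDiracs B a) ν := by
  rw [wassersteinBarycenterFunctional_uniformAndDiracs (by linarith) hw]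
  refine le_iInf₂ fun γ hγ => ?_
  rw [← lintegral_fst_coupling hp hw hγ]
  exact lintegral_mono fun q =>
    ENNReal.ofReal_le_ofReal (pointCost_barycenterMap_le hp hw q.1 q.2)

lemma functional_map_barycenterMap_le (hp : 1 < p) (hw : ∀ i, 0 < w i)
    [IsProbabilityMeasure ((volume.restrict B).map (barycenterMap p w a))] :
    wassersteinBarycenterFunctional p w (uniformAndDiracs B a)
      ((volume.restrict B).map (barycenterMap p w a)) ≤ optimalCost p w a B := by
  have hT := measurable_barycenterMap (a := a) hp hw
  have hmem : (volume.restrict B).map (fun x => (x, barycenterMap p w a x))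
      ∈ Coupling (volume.restrict B) ((volume.restrict B).map (barycenterMap p w a)) := by
    constructor
    · rw [Measure.fst_map_prodMk hT, Measure.map_id']
    · rw [Measure.snd_map_prodMk measurable_id']
  rw [wassersteinBarycenterFunctional_uniformAndDiracs (by linarith) hw]
  refine (iInf₂_le _ hmem).trans ?_
  rw [lintegral_map (measurable_pointCost_cons p w a measurable_fst measurable_snd).ennreal_ofReal
    (measurable_id'.prodMk hT)]
  exact le_rfl

lemma optimalCost_lt_top (hp : 1 < p) (hw : ∀ i, 0 < w i) (hBm : MeasurableSet B)
    (hB : Bornology.IsBounded B) : optimalCost p w a B < ∞ := by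
  obtain ⟨R, hR⟩ := hB.exists_norm_le
  obtain ⟨M, hM⟩ := (isCompact_closedBall (0 : 𝔼 d) R).bddAbove_image
    (continuous_pointCost_cons hp w a continuous_id continuous_id).continuousOn
  have hle : optimalCost p w a B ≤ ∫⁻ _ in B, ENNReal.ofReal M := by
    refine setLIntegral_mono' hBm fun x hx => ENNReal.ofReal_le_ofReal ?_
    exact (pointCost_barycenterMap_le hp hw x x).trans (hM ⟨x, by simpa using hR x hx, rfl⟩)
  refine hle.trans_lt ?_
  rw [setLIntegral_const]
  exact ENNReal.mul_lt_top ENNReal.ofReal_lt_top hB.measure_lt_top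

lemma isProbWithMoment_map_barycenterMap (hp : 1 < p) (hw : ∀ i, 0 < w i)
    (hBm : MeasurableSet B) (hB : Bornology.IsBounded B) (hB1 : volume B = 1) :
    IsProbWithMoment p ((volume.restrict B).map (barycenterMap p w a)) := by
  have hT := measurable_barycenterMap (a := a) hp hw
  have : IsProbabilityMeasure (volume.restrict B) := ⟨by simp [hB1]⟩
  refine ⟨Measure.isProbabilityMeasure_map hT.aemeasurable, ?_⟩
  rw [lintegral_map (measurable_ofReal_norm_rpow measurable_id' p) hT]
  obtain ⟨R, hR⟩ := (isBounded_preimage_invBarycenter (a := a) hp hw hB).exists_norm_le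
  have hle : ∫⁻ x in B, ENNReal.ofReal (‖barycenterMap p w a x‖ ^ p)
      ≤ ∫⁻ _ in B, ENNReal.ofReal (R ^ p) := by
    refine setLIntegral_mono' hBm fun x hx => ENNReal.ofReal_le_ofReal ?_
    refine Real.rpow_le_rpow (norm_nonneg _) (hR _ ?_) (by linarith)
    rwa [Set.mem_preimage, invBarycenter_barycenterMap hp hw]
  refine hle.trans_lt ?_
  rw [setLIntegral_const]
  exact ENNReal.mul_lt_top ENNReal.ofReal_lt_top hB.measure_lt_top

/-- A Markov-type estimate: mass that a plan places at distance at least ε from the graph of the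
barycenter map pays c on top of the optimal cost. -/
lemma optimalCost_add_le_lintegral (hp : 1 < p) (hw : ∀ i, 0 < w i) (hBm : MeasurableSet B)
    {ν : Measure (𝔼 d)} {γ : Measure ((𝔼 d) × (𝔼 d))}
    (hγ : γ ∈ Coupling (volume.restrict B) ν) {ε c : ℝ} (hc : 0 < c)
    (hgap : ∀ x ∈ B, ∀ y, ε ≤ ‖y - barycenterMap p w a x‖ →
      pointCost p w (consPoint x a) (barycenterMap p w a x) + c
        ≤ pointCost p w (consPoint x a) y) :
    optimalCost p w a B
        + ENNReal.ofReal c * γ {q | ε ≤ ‖q.2 - barycenterMap p w a q.1‖}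
      ≤ ∫⁻ q, ENNReal.ofReal (pointCost p w (consPoint q.1 a) q.2) ∂γ := by
  have hT := measurable_barycenterMap (a := a) hp hw
  have hbad : MeasurableSet {q : (𝔼 d) × (𝔼 d) | ε ≤ ‖q.2 - barycenterMap p w a q.1‖} :=
    measurableSet_le measurable_const (measurable_snd.sub (hT.comp measurable_fst)).norm
  have hae : ∀ᵐ q ∂γ, q.1 ∈ B := by
    have : ∀ᵐ x ∂γ.fst, x ∈ B := by
      rw [hγ.1]
      exact ae_restrict_mem hBm
    exact ae_of_ae_map measurable_fst.aemeasurable this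
  have hm : Measurable fun q : (𝔼 d) × (𝔼 d) =>
      ENNReal.ofReal (pointCost p w (consPoint q.1 a) (barycenterMap p w a q.1)) :=
    (measurable_pointCost_cons p w a measurable_fst (hT.comp measurable_fst)).ennreal_ofReal
  rw [← lintegral_fst_coupling hp hw hγ, ← lintegral_indicator_const hbad,
    ← lintegral_add_left hm]
  refine lintegral_mono_ae (hae.mono fun q hq => ?_)
  by_cases hqb : ε ≤ ‖q.2 - barycenterMap p w a q.1‖
  · rw [Set.indicator_of_mem (by exact hqb),
      ← ENNReal.ofReal_add (pointCost_nonneg hw) hc.le]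
    exact ENNReal.ofReal_le_ofReal (hgap q.1 hq q.2 hqb)
  · rw [Set.indicator_of_notMem (by exact hqb), add_zero]
    exact ENNReal.ofReal_le_ofReal (pointCost_barycenterMap_le hp hw q.1 q.2)

/-- Almost optimal couplings suffice, so no optimal plan has to exist: they concentrate near the
graph of the barycenter map, which compares the two measures on closed sets up to a thickening. -/
lemma eq_map_barycenterMap_of_functional_le (hp : 1 < p) (hw : ∀ i, 0 < w i)
    (hBm : MeasurableSet B) (hB : Bornology.IsBounded B) (hB1 : volume B = 1)
    (ν : Measure (𝔼 d)) [IsProbabilityMeasure ν]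
    (h : wassersteinBarycenterFunctional p w (uniformAndDiracs B a) ν ≤ optimalCost p w a B) :
    ν = (volume.restrict B).map (barycenterMap p w a) := by
  have hT := measurable_barycenterMap (a := a) hp hw
  have : IsProbabilityMeasure (volume.restrict B) := ⟨by simp [hB1]⟩
  have := Measure.isProbabilityMeasure_map (μ := volume.restrict B) hT.aemeasurable
  have hL := optimalCost_lt_top (a := a) hp hw hBm hB
  refine eq_of_forall_isClosed_measure_le fun F hF => ?_
  set μT := (volume.restrict B).map (barycenterMap p w a) with hμT
  have key : ∀ ε > 0, ν F ≤ μT (Metric.cthickening ε F) := by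
    intro ε hε
    obtain ⟨c, hc, hgap⟩ := exists_pointCost_gap (a := a) hp hw
      (isBounded_preimage_invBarycenter (a := a) hp hw hB).isCompact_closure hε
    have hgap' : ∀ x ∈ B, ∀ y, ε ≤ ‖y - barycenterMap p w a x‖ →
        pointCost p w (consPoint x a) (barycenterMap p w a x) + c
          ≤ pointCost p w (consPoint x a) y := by
      intro x hx y hy
      have := hgap (barycenterMap p w a x) (subset_closure
        (by rwa [Set.mem_preimage, invBarycenter_barycenterMap hp hw])) y hy
      rwa [invBarycenter_barycenterMap hp hw] at this
    refine ENNReal.le_of_forall_pos_le_add fun η hη _ => ?_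
    have hc0 : ENNReal.ofReal c ≠ 0 := by simpa using hc
    have hη0 : (η : ℝ≥0∞) ≠ 0 := by simpa using hη.ne'
    -- Slack c · η in the cost leaves mass at most η far from the graph.
    have hlt : wassersteinBarycenterFunctional p w (uniformAndDiracs B a) ν
        < optimalCost p w a B + ENNReal.ofReal c * η :=
      h.trans_lt (ENNReal.lt_add_right hL.ne (mul_ne_zero hc0 hη0))
    rw [wassersteinBarycenterFunctional_uniformAndDiracs (by linarith) hw] at hlt
    simp only [iInf_lt_iff] at hlt
    obtain ⟨γ, hγ, hlt⟩ := hlt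
    have h1 := (optimalCost_add_le_lintegral hp hw hBm hγ hc hgap').trans hlt.le
    have h2 := ENNReal.le_of_add_le_add_left hL.ne h1
    rw [ENNReal.mul_le_mul_iff_right hc0 ENNReal.ofReal_ne_top] at h2
    have hcm : MeasurableSet (Metric.cthickening ε F) := Metric.isClosed_cthickening.measurableSet
    have e1 : ν F = γ (Prod.snd ⁻¹' F) := by rw [← hγ.2, Measure.snd_apply hF.measurableSet]
    have e2 : μT (Metric.cthickening ε F)
        = γ (Prod.fst ⁻¹' (barycenterMap p w a ⁻¹' Metric.cthickening ε F)) := by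
      rw [hμT, Measure.map_apply hT hcm, ← hγ.1, Measure.fst_apply (hT hcm)]
    rw [e1, e2]
    refine (measure_mono ?_).trans ((measure_union_le _ _).trans (add_le_add_right h2 _))
    -- If q.2 lies in F, either q is far from the graph or the image of q.1 lies within ε of F.
    intro q hq
    by_cases hqb : ε ≤ ‖q.2 - barycenterMap p w a q.1‖
    · exact Or.inr hqb
    · refine Or.inl (Metric.mem_cthickening_of_dist_le _ q.2 _ _ hq ?_)
      rw [dist_comm, dist_eq_norm]
      exact (not_le.1 hqb).le
  have hlim := (tendsto_measure_cthickening_of_isClosed (μ := μT)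
    ⟨1, one_pos, measure_ne_top _ _⟩ hF).mono_left (nhdsWithin_le_nhds (s := Set.Ioi 0))
  exact ge_of_tendsto hlim (eventually_mem_nhdsWithin.mono key)

theorem isWassersteinBarycenter_uniformAndDiracs_iff (hp : 1 < p) (hw : ∀ i, 0 < w i)
    (hBm : MeasurableSet B) (hB : Bornology.IsBounded B) (hB1 : volume B = 1)
    (ν : Measure (𝔼 d)) :
    IsWassersteinBarycenter p w (uniformAndDiracs B a) ν
      ↔ ν = (volume.restrict B).map (barycenterMap p w a) := by
  have hmom := isProbWithMoment_map_barycenterMap (a := a) hp hw hBm hB hB1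
  have := hmom.1
  constructor
  · rintro ⟨⟨hν, -⟩, h⟩
    exact eq_map_barycenterMap_of_functional_le hp hw hBm hB hB1 ν
      ((h _ hmom).trans (functional_map_barycenterMap_le hp hw))
  · rintro rfl
    refine ⟨hmom, fun ν' hν' => ?_⟩
    have := hν'.1
    exact (functional_map_barycenterMap_le hp hw).trans (optimalCost_le hp hw ν')

end Transport

/-! ### Determinant bounds from operator bounds -/

section Determinant

variable {E : Type*} [NormedAddCommGroup E] [NormedSpace ℝ E] [FiniteDimensional ℝ E]

-- The determinant is homogeneous of degree dim E and bounded on the compact unit ball.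
variable (E) in
lemma exists_abs_det_le :
    ∃ C > 0, ∀ M : E →L[ℝ] E, |M.det| ≤ C * ‖M‖ ^ Module.finrank ℝ E := by
  have : ProperSpace (E →L[ℝ] E) := FiniteDimensional.proper ℝ _
  have hcont : Continuous fun M : E →L[ℝ] E => |M.det| :=
    continuous_abs.comp ContinuousLinearMap.continuous_det
  obtain ⟨C, hC⟩ := (isCompact_closedBall (0 : E →L[ℝ] E) 1).bddAbove_image hcont.continuousOn
  refine ⟨max C 1, by positivity, fun M => ?_⟩
  obtain ⟨M', hM', hM⟩ : ∃ M' : E →L[ℝ] E, ‖M'‖ ≤ 1 ∧ M = ‖M‖ • M' := by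
    rcases eq_or_ne M 0 with rfl | h
    · exact ⟨0, by simp, by simp⟩
    · have := norm_pos_iff.2 h
      refine ⟨‖M‖⁻¹ • M, ?_, by rw [smul_inv_smul₀ this.ne']⟩
      rw [norm_smul, norm_inv, norm_norm, inv_mul_cancel₀ this.ne']
  have hdet : M.det = ‖M‖ ^ Module.finrank ℝ E * M'.det := by
    conv_lhs => rw [hM]
    simp only [ContinuousLinearMap.det, ContinuousLinearMap.toLinearMap_smul,
      LinearMap.det_smul]
  rw [hdet, abs_mul, abs_of_nonneg (by positivity : 0 ≤ ‖M‖ ^ Module.finrank ℝ E), mul_comm]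
  refine mul_le_mul_of_nonneg_right (le_max_of_le_left ?_) (by positivity)
  exact hC ⟨M', by simpa using hM', rfl⟩

-- The upper bound applied to the inverse, whose norm is at most 1/k.
variable (E) in
lemma exists_le_abs_det :
    ∃ c > 0, ∀ (M : E →L[ℝ] E) (k : ℝ), 0 < k → (∀ x, k * ‖x‖ ≤ ‖M x‖) →
      c * k ^ Module.finrank ℝ E ≤ |M.det| := by
  obtain ⟨C, hC, h⟩ := exists_abs_det_le E
  refine ⟨C⁻¹, inv_pos.2 hC, fun M k hk hM => ?_⟩
  have hinj : Function.Injective (M : E →ₗ[ℝ] E) := by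
    rw [injective_iff_map_eq_zero]
    intro x hx
    have h1 := hM x
    rw [show M x = 0 from hx, norm_zero] at h1
    exact norm_le_zero_iff.1 (nonpos_of_mul_nonpos_right h1 hk)
  let e := (LinearEquiv.ofInjectiveEndo (M : E →ₗ[ℝ] E) hinj).toContinuousLinearEquiv
  have he : ∀ x, e x = M x := fun x => rfl
  let N : E →L[ℝ] E := e.symm
  have hMN : (M : E →ₗ[ℝ] E) ∘ₗ (N : E →ₗ[ℝ] E) = LinearMap.id := by
    ext x
    exact e.apply_symm_apply x
  have hN : ‖N‖ ≤ k⁻¹ := by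
    refine ContinuousLinearMap.opNorm_le_bound _ (by positivity) fun y => ?_
    have h1 := hM (N y)
    rw [← he, show e (N y) = y from e.apply_symm_apply y] at h1
    rw [inv_mul_eq_div, le_div_iff₀ hk]
    linarith
  have hdet : |M.det| * |N.det| = 1 := by
    rw [← abs_mul, ContinuousLinearMap.det, ContinuousLinearMap.det, ← LinearMap.det_comp, hMN,
      LinearMap.det_id, abs_one]
  have h2 : |N.det| ≤ C * (k ^ Module.finrank ℝ E)⁻¹ := by
    refine (h N).trans ?_
    rw [← inv_pow]
    gcongr
  have hk' : 0 < k ^ Module.finrank ℝ E := by positivity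
  have h3 : 1 ≤ |M.det| * (C * (k ^ Module.finrank ℝ E)⁻¹) := by
    rw [← hdet]
    gcongr
  rw [inv_mul_eq_div, div_le_iff₀ hC]
  calc k ^ Module.finrank ℝ E
      ≤ k ^ Module.finrank ℝ E * (|M.det| * (C * (k ^ Module.finrank ℝ E)⁻¹)) :=
        le_mul_of_one_le_right hk'.le h3
    _ = |M.det| * C := by field_simp

end Determinant

/-! ### Integrability of determinants with power singularities -/

section Integrability

variable {E : Type*} [NormedAddCommGroup E] [NormedSpace ℝ E] [FiniteDimensional ℝ E]
  [Nontrivial E] [MeasurableSpace E] [BorelSpace E] (μ : Measure E) [μ.IsAddHaarMeasure]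

/-- Polar coordinates reduce the question to t^(D-1+s) on (0, R), where D is the dimension. -/
lemma integrableOn_ball_norm_sub_rpow_iff (a : E) {R s : ℝ} (hR : 0 < R) :
    IntegrableOn (fun z => ‖z - a‖ ^ s) (Metric.ball a R) μ ↔ -(Module.finrank ℝ E : ℝ) < s := by
  have hd : 1 ≤ Module.finrank ℝ E := Module.finrank_pos
  let f : ℝ → ℝ := (Set.Iio R).indicator fun t => t ^ s
  have e1 : (Metric.ball a R).indicator (fun z => ‖z - a‖ ^ s) = fun z => f ‖z - a‖ := by
    ext z
    by_cases hz : ‖z - a‖ < R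
    · simp [f, Set.indicator, dist_eq_norm, hz]
    · simp [f, Set.indicator, dist_eq_norm, hz]
  have htr : Integrable (fun z => f ‖z - a‖) μ ↔ Integrable (fun z => f ‖z‖) μ :=
    (measurePreserving_sub_right μ a).integrable_comp_emb
      (MeasurableEquiv.subRight a).measurableEmbedding (g := fun z => f ‖z‖)
  rw [← integrable_indicator_iff measurableSet_ball, e1,
    htr, integrable_fun_norm_addHaar μ]
  have e2 : (fun y => y ^ (Module.finrank ℝ E - 1) • f y)
      = (Set.Iio R).indicator fun y => y ^ (Module.finrank ℝ E - 1) * y ^ s := by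
    ext y
    by_cases hy : y < R <;> simp [f, Set.indicator, hy]
  have e3 : ∀ y ∈ Set.Ioo 0 R, y ^ (Module.finrank ℝ E - 1) * y ^ s
      = y ^ ((Module.finrank ℝ E - 1 : ℝ) + s) := by
    intro y hy
    have : (Module.finrank ℝ E - 1 : ℝ) = ((Module.finrank ℝ E - 1 : ℕ) : ℝ) := by
      rw [Nat.cast_sub hd, Nat.cast_one]
    rw [Real.rpow_add hy.1, this, Real.rpow_natCast]
  rw [e2, IntegrableOn, integrable_indicator_iff measurableSet_Iio, IntegrableOn,
    Measure.restrict_restrict measurableSet_Iio, Set.inter_comm, Set.Ioi_inter_Iio,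
    ← IntegrableOn, integrableOn_congr_fun e3 measurableSet_Ioo,
    intervalIntegral.integrableOn_Ioo_rpow_iff hR]
  constructor <;> intro h <;> linarith

lemma memLp_norm_sub_rpow_restrict (a : E) {U : Set E} (hU : Bornology.IsBounded U) {s r : ℝ}
    (hr : 0 < r) (h : -(Module.finrank ℝ E : ℝ) < s * r) :
    MemLp (fun z => ‖z - a‖ ^ s) (ENNReal.ofReal r) (μ.restrict U) := by
  obtain ⟨R, hR0, hR⟩ : ∃ R > 0, U ⊆ Metric.ball a R := by
    obtain ⟨R, hR⟩ := hU.subset_ball a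
    exact ⟨max R 1, by positivity, hR.trans (Metric.ball_subset_ball (le_max_left _ _))⟩
  have hm : Measurable fun z : E => ‖z - a‖ ^ s :=
    (measurable_id.sub measurable_const).norm.pow_const s
  rw [← integrable_norm_rpow_iff hm.aestronglyMeasurable (by simpa using hr)
    ENNReal.ofReal_ne_top, ENNReal.toReal_ofReal hr.le]
  have e : (fun z : E => ‖‖z - a‖ ^ s‖ ^ r) = fun z => ‖z - a‖ ^ (s * r) := by
    ext z
    rw [Real.norm_of_nonneg (by positivity), ← Real.rpow_mul (norm_nonneg _)]
  rw [e]
  exact ((integrableOn_ball_norm_sub_rpow_iff μ a hR0).2 h).mono_set hR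

/-- Upper bounds on a field of endomorphisms with finitely many power singularities of order `β`
give integrability of its determinant for exponents below `1 / β`. -/
lemma memLp_det_of_norm_le {ι : Type*} [Fintype ι] {β C : ℝ} {U : Set E}
    (hU : MeasurableSet U) (hUb : Bornology.IsBounded U) {A : E → E →L[ℝ] E} (hA : Measurable A)
    (a : ι → E)
    (hle : ∀ z ∈ U, (∀ j, z ≠ a j) → ‖A z‖ ≤ C * (1 + ∑ j, ‖z - a j‖ ^ (-β)))
    {q : ℝ≥0∞} (hq1 : 1 ≤ q) (hβ : 0 < β) (hq : q < ENNReal.ofReal (1 / β)) :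
    MemLp (fun z => |(A z).det|) q (μ.restrict U) := by
  set D := Module.finrank ℝ E with hD
  have hd : 0 < D := Module.finrank_pos
  have hd' : (0 : ℝ) < D := by exact_mod_cast hd
  obtain ⟨r, hr, rfl⟩ : ∃ r : ℝ, 0 < r ∧ q = ENNReal.ofReal r := by
    refine ⟨q.toReal, ENNReal.toReal_pos (by positivity) hq.ne_top, ?_⟩
    rw [ENNReal.ofReal_toReal hq.ne_top]
  have hrβ : r * β < 1 := by
    rw [ENNReal.ofReal_lt_ofReal_iff (by positivity)] at hq
    rwa [lt_div_iff₀ hβ] at hq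
  have : IsFiniteMeasure (μ.restrict U) := ⟨by simpa using hUb.measure_lt_top⟩
  set h : E → ℝ := fun z => 1 + ∑ j, ‖z - a j‖ ^ (-β)
  have hh0 : ∀ z, 0 ≤ h z := fun z => by positivity
  -- The determinant is bounded by a multiple of h^D, so its L^r bound needs h in L^(Dr); the
  -- condition Drβ < D is rβ < 1.
  have hh : MemLp h (ENNReal.ofReal (D * r)) (μ.restrict U) := by
    have h1 : ∀ j ∈ (Finset.univ : Finset ι),
        MemLp (fun z => ‖z - a j‖ ^ (-β)) (ENNReal.ofReal (D * r)) (μ.restrict U) := by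
      intro j _
      refine memLp_norm_sub_rpow_restrict μ (a j) hUb (mul_pos hd' hr) ?_
      rw [← hD]
      nlinarith
    have h2 : MemLp (fun _ : E => (1 : ℝ)) (ENNReal.ofReal (D * r)) (μ.restrict U) :=
      memLp_const 1
    exact h2.add (memLp_finsetSum _ h1)
  have hh2 := hh.norm_rpow_div (D : ℝ≥0∞)
  have e : ENNReal.ofReal (D * r) / (D : ℝ≥0∞) = ENNReal.ofReal r := by
    rw [← ENNReal.ofReal_natCast, ← ENNReal.ofReal_div_of_pos hd', mul_div_cancel_left₀ _ hd'.ne']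
  rw [e] at hh2
  simp only [ENNReal.toReal_natCast, Real.rpow_natCast] at hh2
  obtain ⟨K, hK, hdet⟩ := exists_abs_det_le E
  have hmeas : Measurable fun z => |(A z).det| :=
    (continuous_abs.comp ContinuousLinearMap.continuous_det).measurable.comp hA
  refine hh2.of_le_mul (c := K * C ^ D) hmeas.aestronglyMeasurable ?_
  have hnull : ∀ᵐ z ∂(μ.restrict U), ∀ j, z ≠ a j := by
    rw [ae_all_iff]
    intro j
    refine ae_restrict_of_ae ?_
    rw [ae_iff]
    simp
  filter_upwards [hnull, ae_restrict_mem hU] with z hz hzU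
  have h1 := hle z hzU hz
  rw [norm_abs_eq_norm, Real.norm_eq_abs, norm_pow, norm_norm, Real.norm_of_nonneg (hh0 z),
    mul_assoc, ← mul_pow]
  exact (hdet _).trans (by gcongr)

/-- A lower bound with a power singularity of order `β` prevents integrability of the determinant
for exponents at least `1 / β`. -/
lemma not_memLp_det_of_le_norm {β c : ℝ} (hβ : 0 < β) (hc : 0 < c) {U : Set E}
    (hUb : Bornology.IsBounded U) {A : E → E →L[ℝ] E} {a : E} (hUa : U ∈ 𝓝 a)
    (hge : ∀ᶠ z in 𝓝[≠] a, ∀ x, c * ‖z - a‖ ^ (-β) * ‖x‖ ≤ ‖A z x‖)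
    {q : ℝ≥0∞} (hq : ENNReal.ofReal (1 / β) ≤ q) :
    ¬ MemLp (fun z => |(A z).det|) q (μ.restrict U) := by
  intro hmem
  set D := Module.finrank ℝ E with hD
  have hβ' : 0 < 1 / β := by positivity
  have : IsFiniteMeasure (μ.restrict U) := ⟨by simpa using hUb.measure_lt_top⟩
  -- On a finite measure space it suffices to refute the endpoint 1/β, where the lower bound becomes
  -- |z - a|^(-D), which is just not integrable.
  have h1 := (hmem.mono_exponent hq).integrable_norm_rpow (by simpa using hβ)
    ENNReal.ofReal_ne_top
  rw [ENNReal.toReal_ofReal hβ'.le] at h1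
  have hev : ∀ᶠ z in 𝓝 a, z ∈ U ∧ (z ≠ a → ∀ x, c * ‖z - a‖ ^ (-β) * ‖x‖ ≤ ‖A z x‖) :=
    (eventually_mem_set.2 hUa).and (eventually_nhdsWithin_iff.1 hge)
  obtain ⟨ρ, hρ, hball⟩ := Metric.eventually_nhds_iff_ball.1 hev
  obtain ⟨k, hk, hdet⟩ := exists_le_abs_det E
  have h2 : IntegrableOn (fun z => ‖|(A z).det|‖ ^ (1 / β)) (Metric.ball a ρ) μ :=
    IntegrableOn.mono_set h1 fun z hz => (hball z hz).1
  have hpos : 0 < (k * c ^ D) ^ (1 / β) := by positivity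
  have h3 : IntegrableOn (fun z => (k * c ^ D) ^ (1 / β) * ‖z - a‖ ^ (-(D : ℝ)))
      (Metric.ball a ρ) μ := by
    refine Integrable.mono' h2 ?_ ?_
    · exact (((measurable_id.sub measurable_const).norm.pow_const _).const_mul
        _).aestronglyMeasurable
    · have hnull : ∀ᵐ z ∂(μ.restrict (Metric.ball a ρ)), z ≠ a := by
        refine ae_restrict_of_ae ?_
        rw [ae_iff]
        simp
      filter_upwards [hnull, ae_restrict_mem measurableSet_ball] with z hz hzb
      have hza : 0 < ‖z - a‖ := norm_pos_iff.2 (sub_ne_zero.2 hz)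
      have h4 := hdet (A z) (c * ‖z - a‖ ^ (-β)) (by positivity) ((hball z hzb).2 hz)
      rw [Real.norm_of_nonneg (by positivity), norm_abs_eq_norm, Real.norm_eq_abs]
      calc (k * c ^ D) ^ (1 / β) * ‖z - a‖ ^ (-(D : ℝ))
          = (k * (c * ‖z - a‖ ^ (-β)) ^ D) ^ (1 / β) := by
            rw [mul_pow, ← mul_assoc, Real.mul_rpow (x := k * c ^ D) (by positivity)
              (by positivity), ← Real.rpow_natCast (‖z - a‖ ^ (-β)), ← Real.rpow_mul hza.le,
              ← Real.rpow_mul hza.le]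
            congr 2
            field_simp
        _ ≤ _ := Real.rpow_le_rpow (by positivity) h4 hβ'.le
  have h5 : IntegrableOn (fun z => ‖z - a‖ ^ (-(D : ℝ))) (Metric.ball a ρ) μ := by
    have := h3.const_mul ((k * c ^ D) ^ (1 / β))⁻¹
    simp only [inv_mul_cancel_left₀ hpos.ne'] at this
    exact this
  exact lt_irrefl _ ((integrableOn_ball_norm_sub_rpow_iff μ a hρ).1 h5)

end Integrability

/-! ### The density of the barycenter -/

section Density

variable {d n : ℕ}

local notation "𝔼" d => EuclideanSpace ℝ (Fin d)

variable {p : ℝ} {w : Fin (n + 1) → ℝ} {a : Fin n → 𝔼 d} {B : Set (𝔼 d)}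

/-- Change of variables for the injective S. The finite exceptional set and its image under S are
both null, as the dimension is positive. -/
lemma map_barycenterMap_eq_withDensity [Nontrivial (𝔼 d)] (hp : 1 < p) (hw : ∀ i, 0 < w i)
    (hBm : MeasurableSet B) {F : Set (𝔼 d)} (hF : F.Finite)
    (hdiff : ∀ z ∉ F,
      DifferentiableAt ℝ (invBarycenter p (w 0) (fun i => w i.succ) a) z) :
    (volume.restrict B).map (barycenterMap p w a)
      = (volume : Measure (𝔼 d)).withDensity fun z => ENNReal.ofReal
          ((invBarycenter p (w 0) (fun i => w i.succ) a ⁻¹' B).indicator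
            (fun z => |(fderiv ℝ (invBarycenter p (w 0) (fun i => w i.succ) a) z).det|) z) := by
  set S := invBarycenter p (w 0) (fun i => w i.succ) a with hS
  have hSc : Continuous S := continuous_invBarycenter hp _ _
  have hSi : Function.Injective S := (bijective_invBarycenter hp hw).1
  have hUm : MeasurableSet (S ⁻¹' B) := hSc.measurable hBm
  ext A hA
  have hAU : MeasurableSet ((S ⁻¹' B) ∩ A) := hUm.inter hA
  have e1 : ∀ z, ENNReal.ofReal ((S ⁻¹' B).indicator (fun z => |(fderiv ℝ S z).det|) z)
      = (S ⁻¹' B).indicator (fun z => ENNReal.ofReal |(fderiv ℝ S z).det|) z := by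
    intro z
    by_cases hz : z ∈ S ⁻¹' B
    · simp only [Set.indicator_of_mem hz]
    · simp only [Set.indicator_of_notMem hz, ENNReal.ofReal_zero]
  rw [Measure.map_apply (measurable_barycenterMap hp hw) hA, preimage_barycenterMap hp hw,
    Measure.restrict_apply
      ((hSc.measurableEmbedding hSi).measurableSet_image.2 hA), withDensity_apply _ hA]
  simp only [e1]
  rw [setLIntegral_indicator hUm]
  have e2 : S '' A ∩ B = S '' ((S ⁻¹' B) ∩ A) := by
    rw [Set.inter_comm, ← Set.image_preimage_inter, Set.inter_comm, Set.inter_comm]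
  have e3 : volume (S '' ((S ⁻¹' B) ∩ A)) = volume (S '' (((S ⁻¹' B) ∩ A) \ F)) := by
    rw [Set.image_sdiff hSi, measure_sdiff_null ((hF.image S).measure_zero _)]
  have e4 : ∫⁻ z in (S ⁻¹' B) ∩ A, ENNReal.ofReal |(fderiv ℝ S z).det|
      = ∫⁻ z in ((S ⁻¹' B) ∩ A) \ F, ENNReal.ofReal |(fderiv ℝ S z).det| :=
    setLIntegral_congr (sdiff_null_ae_eq_self (hF.measure_zero _)).symm
  rw [e2, e3, e4, lintegral_abs_det_fderiv_eq_addHaar_image volume (hAU.diff hF.measurableSet)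
    (fun z hz => (hdiff z hz.2).hasFDerivAt.hasFDerivWithinAt) hSi.injOn]

lemma isBarycenterDensity_indicator [Nontrivial (𝔼 d)] (hp : 1 < p) (hw : ∀ i, 0 < w i)
    (hBm : MeasurableSet B) (hB : Bornology.IsBounded B) (hB1 : volume B = 1)
    {F : Set (𝔼 d)} (hF : F.Finite)
    (hdiff : ∀ z ∉ F,
      DifferentiableAt ℝ (invBarycenter p (w 0) (fun i => w i.succ) a) z) :
    IsBarycenterDensity p w (uniformAndDiracs B a)
      ((invBarycenter p (w 0) (fun i => w i.succ) a ⁻¹' B).indicator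
        (fun z => |(fderiv ℝ (invBarycenter p (w 0) (fun i => w i.succ) a) z).det|)) := by
  have hSc : Continuous (invBarycenter p (w 0) (fun i => w i.succ) a) :=
    continuous_invBarycenter hp _ _
  refine ⟨?_, fun z => Set.indicator_nonneg (fun _ _ => abs_nonneg _) z, fun ν => ?_⟩
  · exact ((continuous_abs.comp ContinuousLinearMap.continuous_det).measurable.comp
      (measurable_fderiv ℝ _)).indicator (hSc.measurable hBm)
  · rw [isWassersteinBarycenter_uniformAndDiracs_iff hp hw hBm hB hB1,
      map_barycenterMap_eq_withDensity hp hw hBm hF hdiff]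

/-- Integrability of the barycenter density from upper and lower bounds on the derivative of
`invBarycenter` near its singularities. -/
lemma memLp_indicator_det_iff [Nontrivial (𝔼 d)] {ι : Type*} [Fintype ι] {β C c : ℝ} (hβ : 0 < β)
    (hc : 0 < c) {S : (𝔼 d) → (𝔼 d)} {U : Set (𝔼 d)} (hU : IsOpen U)
    (hUb : Bornology.IsBounded U) (b : ι → 𝔼 d)
    (hle : ∀ z ∈ U, (∀ j, z ≠ b j) →
      ‖fderiv ℝ S z‖ ≤ C * (1 + ∑ j, ‖z - b j‖ ^ (-β)))
    {z₀ : 𝔼 d} (hz₀ : z₀ ∈ U)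
    (hge : ∀ᶠ z in 𝓝[≠] z₀, ∀ x, c * ‖z - z₀‖ ^ (-β) * ‖x‖ ≤ ‖fderiv ℝ S z x‖)
    (q : ℝ≥0∞) (hq : 1 ≤ q) :
    MemLp (U.indicator fun z => |(fderiv ℝ S z).det|) q volume ↔ q < ENNReal.ofReal (1 / β) := by
  rw [memLp_indicator_iff_restrict hU.measurableSet]
  constructor
  · intro h
    by_contra! hq'
    exact not_memLp_det_of_le_norm volume hβ hc hUb (hU.mem_nhds hz₀) hge hq' h
  · exact memLp_det_of_norm_le volume hU.measurableSet hUb (measurable_fderiv ℝ S) b hle hq hβ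

end Density

/-! ### Two-sided bounds on the derivative of the inverse map -/

section Derivative

variable {d n : ℕ}

local notation "𝔼" d => EuclideanSpace ℝ (Fin d)

variable {p r w₀ : ℝ} {c : Fin n → ℝ} {a : Fin n → 𝔼 d} {z : 𝔼 d}

/-- The derivative of `powField`. -/
noncomputable def powFieldDeriv (r : ℝ) (c : Fin n → ℝ) (a : Fin n → 𝔼 d) (z : 𝔼 d) :
    (𝔼 d) →L[ℝ] (𝔼 d) :=
  ∑ j, c j • powMapDeriv r (z - a j)

lemma hasFDerivAt_powField (h : ∀ j, z ≠ a j ∨ 0 < r) :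
    HasFDerivAt (powField r c a) (powFieldDeriv r c a z) z := by
  refine HasFDerivAt.fun_sum fun j _ => HasFDerivAt.const_smul ?_ (c j)
  have h1 : HasFDerivAt (powMap r) (powMapDeriv r (z - a j)) (z - a j) :=
    hasFDerivAt_powMap ((h j).imp_left sub_ne_zero.2)
  exact h1.comp z ((hasFDerivAt_id z).sub_const (a j))

lemma norm_powFieldDeriv_le (hc : ∀ j, 0 < c j) :
    ‖powFieldDeriv r c a z‖ ≤ (1 + |r|) * ∑ j, c j * ‖z - a j‖ ^ r := by
  refine (norm_sum_le _ _).trans ?_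
  rw [Finset.mul_sum]
  refine Finset.sum_le_sum fun j _ => ?_
  rw [norm_smul, Real.norm_of_nonneg (hc j).le]
  have := mul_le_mul_of_nonneg_left (norm_powMapDeriv_le r (z - a j)) (hc j).le
  linarith

lemma le_norm_powFieldDeriv_apply (hc : ∀ j, 0 < c j) (x : 𝔼 d) :
    min 1 (1 + r) * (∑ j, c j * ‖z - a j‖ ^ r) * ‖x‖ ≤ ‖powFieldDeriv r c a z x‖ := by
  rcases eq_or_ne x 0 with rfl | hx
  · simp
  have h1 : min 1 (1 + r) * (∑ j, c j * ‖z - a j‖ ^ r) * ‖x‖ ^ 2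
      ≤ inner ℝ (powFieldDeriv r c a z x) x := by
    simp only [powFieldDeriv, sum_apply, smul_apply, sum_inner, real_inner_smul_left,
      Finset.mul_sum, Finset.sum_mul]
    refine Finset.sum_le_sum fun j _ => ?_
    have := mul_le_mul_of_nonneg_left (le_inner_powMapDeriv r (z - a j) x) (hc j).le
    linarith
  have h2 := h1.trans (real_inner_le_norm _ _)
  refine le_of_mul_le_mul_right ?_ (norm_pos_iff.2 hx)
  linarith

/-- Each power map is differentiable away from the origin, and also there if its exponent is
positive: p - 2 > 0 for the inner maps, 1/(p-1) - 1 > 0, that is p < 2, for the outer one. -/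
lemma hasFDerivAt_invBarycenter (hp : 1 < p) (hw₀ : 0 < w₀) (h : ∀ j, z ≠ a j ∨ 2 < p)
    (hz : powField (p - 2) c a z ≠ 0 ∨ p < 2) :
    HasFDerivAt (invBarycenter p w₀ c a)
      (ContinuousLinearMap.id ℝ (𝔼 d)
        + (powMapDeriv (1 / (p - 1) - 1) (w₀⁻¹ • powField (p - 2) c a z)).comp
            (w₀⁻¹ • powFieldDeriv (p - 2) c a z)) z := by
  have h1 : HasFDerivAt (powField (p - 2) c a) (powFieldDeriv (p - 2) c a z) z :=
    hasFDerivAt_powField fun j => (h j).imp_right sub_pos.2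
  have h2 : HasFDerivAt (powMap (1 / (p - 1) - 1))
      (powMapDeriv (1 / (p - 1) - 1) (w₀⁻¹ • powField (p - 2) c a z))
      (w₀⁻¹ • powField (p - 2) c a z) := by
    refine hasFDerivAt_powMap (hz.imp (fun h => smul_ne_zero (inv_ne_zero hw₀.ne') h) fun h => ?_)
    rw [sub_pos, lt_div_iff₀ (by linarith)]
    linarith
  have h3 : HasFDerivAt (fun z => w₀⁻¹ • powField (p - 2) c a z)
      (w₀⁻¹ • powFieldDeriv (p - 2) c a z) z := h1.const_smul w₀⁻¹
  exact (hasFDerivAt_id z).add (HasFDerivAt.comp (g := powMap (1 / (p - 1) - 1)) z h2 h3)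

lemma norm_fderiv_invBarycenter_le (hp : 1 < p) (hw₀ : 0 < w₀) (hc : ∀ j, 0 < c j)
    (h : ∀ j, z ≠ a j ∨ 2 < p) (hz : powField (p - 2) c a z ≠ 0 ∨ p < 2) :
    ‖fderiv ℝ (invBarycenter p w₀ c a) z‖
      ≤ 1 + (1 + |1 / (p - 1) - 1|) * ‖w₀⁻¹ • powField (p - 2) c a z‖ ^ (1 / (p - 1) - 1)
          * (w₀⁻¹ * ((1 + |p - 2|) * ∑ j, c j * ‖z - a j‖ ^ (p - 2))) := by
  rw [(hasFDerivAt_invBarycenter hp hw₀ h hz).fderiv]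
  refine (norm_add_le _ _).trans (add_le_add ContinuousLinearMap.norm_id_le ?_)
  refine (ContinuousLinearMap.opNorm_comp_le _ _).trans ?_
  refine mul_le_mul (norm_powMapDeriv_le _ _) ?_ (norm_nonneg _) (by positivity)
  rw [norm_smul, Real.norm_of_nonneg (by positivity)]
  exact mul_le_mul_of_nonneg_left (norm_powFieldDeriv_le hc) (by positivity)

/-- Lower bounds multiply under composition. The identity summand costs the -1, which is negligible
where the other factor blows up. -/
lemma le_norm_fderiv_invBarycenter_apply (hp : 1 < p) (hw₀ : 0 < w₀) (hc : ∀ j, 0 < c j)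
    (h : ∀ j, z ≠ a j ∨ 2 < p) (hz : powField (p - 2) c a z ≠ 0 ∨ p < 2) (x : 𝔼 d) :
    (min 1 (1 / (p - 1)) * ‖w₀⁻¹ • powField (p - 2) c a z‖ ^ (1 / (p - 1) - 1)
        * (w₀⁻¹ * (min 1 (p - 1) * ∑ j, c j * ‖z - a j‖ ^ (p - 2))) - 1) * ‖x‖
      ≤ ‖fderiv ℝ (invBarycenter p w₀ c a) z x‖ := by
  rw [(hasFDerivAt_invBarycenter hp hw₀ h hz).fderiv]
  set y := w₀⁻¹ • powFieldDeriv (p - 2) c a z x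
  have h1 := le_norm_powMapDeriv_apply (1 / (p - 1) - 1) (w₀⁻¹ • powField (p - 2) c a z) y
  rw [add_sub_cancel] at h1
  have h2 : w₀⁻¹ * (min 1 (p - 1) * ∑ j, c j * ‖z - a j‖ ^ (p - 2)) * ‖x‖ ≤ ‖y‖ := by
    have := le_norm_powFieldDeriv_apply (r := p - 2) (a := a) (z := z) hc x
    rw [show 1 + (p - 2) = p - 1 by ring] at this
    rw [norm_smul, Real.norm_of_nonneg (by positivity), mul_assoc]
    exact mul_le_mul_of_nonneg_left this (by positivity)
  have h3 : 0 ≤ min 1 (1 / (p - 1)) := by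
    have : 0 < 1 / (p - 1) := by apply one_div_pos.2; linarith
    positivity
  set V := powMapDeriv (1 / (p - 1) - 1) (w₀⁻¹ • powField (p - 2) c a z)
  have h4 : (ContinuousLinearMap.id ℝ (𝔼 d) + V.comp (w₀⁻¹ • powFieldDeriv (p - 2) c a z)) x
      = x + V y := by simp [y]
  have h5 : ‖V y‖ - ‖x‖ ≤ ‖x + V y‖ := by
    have := norm_sub_norm_le (V y) (-x)
    rwa [norm_neg, sub_neg_eq_add, add_comm] at this
  have h6 : min 1 (1 / (p - 1)) * ‖w₀⁻¹ • powField (p - 2) c a z‖ ^ (1 / (p - 1) - 1)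
        * (w₀⁻¹ * (min 1 (p - 1) * ∑ j, c j * ‖z - a j‖ ^ (p - 2)) * ‖x‖)
      ≤ min 1 (1 / (p - 1)) * ‖w₀⁻¹ • powField (p - 2) c a z‖ ^ (1 / (p - 1) - 1) * ‖y‖ := by
    gcongr
  rw [h4]
  linarith

end Derivative

/-! ### Critical exponents for p > 2 and p < 2 -/

section Exponents

variable {d n : ℕ}

local notation "𝔼" d => EuclideanSpace ℝ (Fin d)

lemma exists_le_of_isBounded {f : (𝔼 d) → ℝ} (hf : Continuous f) {U : Set (𝔼 d)}
    (hU : Bornology.IsBounded U) : ∃ M > 0, ∀ z ∈ U, f z ≤ M := by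
  obtain ⟨M, hM⟩ := hU.isCompact_closure.bddAbove_image hf.continuousOn
  exact ⟨max M 1, by positivity, fun z hz =>
    le_max_of_le_left (hM ⟨z, subset_closure hz, rfl⟩)⟩

lemma eventually_half_le_of_sub_one_le {E : Type*} [NormedAddCommGroup E] [NormedSpace ℝ E]
    {A : E → E →L[ℝ] E} {z₀ : E} {c s : ℝ} (hc : 0 < c) (hs : s < 0)
    (h : ∀ᶠ z in 𝓝[≠] z₀, ∀ x, (c * ‖z - z₀‖ ^ s - 1) * ‖x‖ ≤ ‖A z x‖) :
    ∀ᶠ z in 𝓝[≠] z₀, ∀ x, c / 2 * ‖z - z₀‖ ^ s * ‖x‖ ≤ ‖A z x‖ := by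
  have hT : Tendsto (fun z => c / 2 * ‖z - z₀‖ ^ s) (𝓝[≠] z₀) atTop :=
    ((tendsto_rpow_neg_nhdsGT_zero hs).comp (tendsto_norm_sub_self_nhdsNE z₀)).const_mul_atTop
      (half_pos hc)
  filter_upwards [h, hT.eventually_ge_atTop 1] with z hz h1 x
  refine le_trans (mul_le_mul_of_nonneg_right ?_ (norm_nonneg x)) (hz x)
  linarith

variable {r : ℝ} {c : Fin n → ℝ} {a : Fin n → 𝔼 d}

/-- Strong monotonicity of the field at its zero, combined with Cauchy–Schwarz, forces at least
linear growth. -/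
lemma le_norm_powField (hr : 0 ≤ r) (hc : ∀ j, 0 < c j) {z₀ : 𝔼 d} (h0 : powField r c a z₀ = 0)
    (z : 𝔼 d) :
    (∑ j, c j * ‖z₀ - a j‖ ^ r) / 2 * ‖z - z₀‖ ≤ ‖powField r c a z‖ := by
  rcases eq_or_ne z z₀ with rfl | hz
  · simp
  have h1 : (∑ j, c j * ‖z₀ - a j‖ ^ r) / 2 * ‖z - z₀‖ ^ 2
      ≤ inner ℝ (powField r c a z - powField r c a z₀) (z - z₀) := by
    simp only [powField, ← Finset.sum_sub_distrib, ← smul_sub, sum_inner, real_inner_smul_left,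
      Finset.sum_div, Finset.sum_mul]
    refine Finset.sum_le_sum fun j _ => ?_
    have := mul_le_mul_of_nonneg_left (le_inner_powMap_sub hr (z - a j) (z₀ - a j)) (hc j).le
    rw [sub_sub_sub_cancel_right] at this
    linarith
  rw [h0, sub_zero] at h1
  have h2 := h1.trans (real_inner_le_norm _ _)
  refine le_of_mul_le_mul_right ?_ (norm_pos_iff.2 (sub_ne_zero.2 hz))
  linarith

/-- This is where the points must not all coincide: otherwise the growth constant of the field would
degenerate at its zero. -/
lemma sum_mul_norm_sub_rpow_pos (hc : ∀ j, 0 < c j) (h : ∃ i j, a i ≠ a j) (z : 𝔼 d) :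
    0 < ∑ j, c j * ‖z - a j‖ ^ r := by
  obtain ⟨j, hj⟩ : ∃ j, z ≠ a j := by
    obtain ⟨i, j, hij⟩ := h
    by_contra! hall
    exact hij ((hall i).symm.trans (hall j))
  refine Finset.sum_pos' (fun i _ => mul_nonneg (hc i).le (by positivity))
    ⟨j, Finset.mem_univ j, mul_pos (hc j) ?_⟩
  exact Real.rpow_pos_of_pos (norm_pos_iff.2 (sub_ne_zero.2 hj)) r

lemma continuous_sum_mul_norm_sub_rpow (hr : 0 ≤ r) (c : Fin n → ℝ) (a : Fin n → 𝔼 d) :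
    Continuous fun z => ∑ j, c j * ‖z - a j‖ ^ r :=
  continuous_finsetSum _ fun _ _ => continuous_const.mul
    ((continuous_id.sub continuous_const).norm.rpow_const fun _ => Or.inr hr)

variable {p w₀ : ℝ} {B : Set (𝔼 d)} {w : Fin (n + 1) → ℝ}

lemma powField_ne_zero (hp : 2 < p) (hc : ∀ j, 0 < c j) (hne : ∃ i j, a i ≠ a j) {z₀ z : 𝔼 d}
    (h0 : powField (p - 2) c a z₀ = 0) (hz : z ≠ z₀) : powField (p - 2) c a z ≠ 0 := by
  have h1 := le_norm_powField (by linarith) hc h0 z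
  have h2 := sum_mul_norm_sub_rpow_pos (r := p - 2) hc hne z₀
  have h3 := norm_pos_iff.2 (sub_ne_zero.2 hz)
  exact norm_pos_iff.1 (lt_of_lt_of_le (by positivity) h1)

lemma one_div_sub_one_neg (hp : 2 < p) : 1 / (p - 1) - 1 < 0 := by
  rw [sub_neg, div_lt_one (by linarith)]
  linarith

/-- The outer exponent is negative, so linear growth of the field from below bounds the singular
factor from above. -/
lemma exists_norm_fderiv_invBarycenter_le_of_two_lt (hp : 2 < p) (hw₀ : 0 < w₀)
    (hc : ∀ j, 0 < c j) (hne : ∃ i j, a i ≠ a j) {z₀ : 𝔼 d} (h0 : powField (p - 2) c a z₀ = 0)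
    {U : Set (𝔼 d)} (hU : Bornology.IsBounded U) :
    ∃ K, ∀ z ∈ U, z ≠ z₀ → ‖fderiv ℝ (invBarycenter p w₀ c a) z‖
      ≤ K * (1 + ‖z - z₀‖ ^ (1 / (p - 1) - 1)) := by
  have hs := one_div_sub_one_neg hp
  have hσ := sum_mul_norm_sub_rpow_pos (r := p - 2) hc hne z₀
  obtain ⟨M, hM0, hM⟩ := exists_le_of_isBounded
    (continuous_sum_mul_norm_sub_rpow (by linarith : 0 ≤ p - 2) c a) hU
  have hv0 := le_norm_powField (by linarith : 0 ≤ p - 2) hc h0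
  set σ := ∑ j, c j * ‖z₀ - a j‖ ^ (p - 2)
  set s := 1 / (p - 1) - 1 with hsdef
  set Q := (1 + |s|) * (w₀⁻¹ * (σ / 2)) ^ s * (w₀⁻¹ * ((1 + |p - 2|) * M)) with hQ
  refine ⟨max 1 Q, fun z hz hzz => ?_⟩
  have hv := powField_ne_zero hp hc hne h0 hzz
  have hpos := norm_pos_iff.2 (sub_ne_zero.2 hzz)
  have h1 := norm_fderiv_invBarycenter_le (a := a) (by linarith) hw₀ hc (fun _ => Or.inr hp)
    (Or.inl hv)
  have h2 : ‖w₀⁻¹ • powField (p - 2) c a z‖ ^ s ≤ (w₀⁻¹ * (σ / 2)) ^ s * ‖z - z₀‖ ^ s := by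
    rw [← Real.mul_rpow (by positivity) (norm_nonneg _), norm_smul,
      Real.norm_of_nonneg (by positivity)]
    refine Real.rpow_le_rpow_of_nonpos (by positivity) ?_ hs.le
    rw [mul_assoc]
    exact mul_le_mul_of_nonneg_left (hv0 z) (by positivity)
  have h3 : 0 ≤ ∑ j, c j * ‖z - a j‖ ^ (p - 2) :=
    Finset.sum_nonneg fun j _ => mul_nonneg (hc j).le (by positivity)
  have h4 : ∑ j, c j * ‖z - a j‖ ^ (p - 2) ≤ M := hM z hz
  set A := ∑ j, c j * ‖z - a j‖ ^ (p - 2)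
  rw [← hsdef] at h1
  calc _ ≤ _ := h1
    _ ≤ 1 + (1 + |s|) * ((w₀⁻¹ * (σ / 2)) ^ s * ‖z - z₀‖ ^ s)
        * (w₀⁻¹ * ((1 + |p - 2|) * M)) := by gcongr
    _ = 1 + Q * ‖z - z₀‖ ^ s := by rw [hQ]; ring
    _ ≤ max 1 Q + max 1 Q * ‖z - z₀‖ ^ s := by
        gcongr
        · exact le_max_left _ _
        · exact le_max_right _ _
    _ = _ := by ring

lemma exists_le_norm_fderiv_invBarycenter_of_two_lt (hp : 2 < p) (hw₀ : 0 < w₀)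
    (hc : ∀ j, 0 < c j) (hne : ∃ i j, a i ≠ a j) {z₀ : 𝔼 d}
    (h0 : powField (p - 2) c a z₀ = 0) :
    ∃ k > 0, ∀ᶠ z in 𝓝[≠] z₀, ∀ x, k * ‖z - z₀‖ ^ (1 / (p - 1) - 1) * ‖x‖
      ≤ ‖fderiv ℝ (invBarycenter p w₀ c a) z x‖ := by
  have hp1 : 1 < p := by linarith
  have hs := one_div_sub_one_neg hp
  have hσ := sum_mul_norm_sub_rpow_pos (r := p - 2) hc hne z₀
  have hσc := continuous_sum_mul_norm_sub_rpow (by linarith : 0 ≤ p - 2) c a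
  set σ : (𝔼 d) → ℝ := fun z => ∑ j, c j * ‖z - a j‖ ^ (p - 2)
  have hσ0 : 0 < σ z₀ := hσ
  -- Differentiability at the zero gives the matching linear upper bound on the field, hence a lower
  -- bound on its negative power.
  obtain ⟨K, hK0, hK⟩ : ∃ K > 0, ∀ᶠ z in 𝓝 z₀, ‖powField (p - 2) c a z‖ ≤ K * ‖z - z₀‖ := by
    have h1 : HasFDerivAt (powField (p - 2) c a) _ z₀ :=
      hasFDerivAt_powField fun _ => Or.inr (sub_pos.2 hp)
    obtain ⟨K, hK0, hK⟩ := h1.isBigO_sub.exists_pos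
    refine ⟨K, hK0, ?_⟩
    simpa [h0] using hK.bound
  have hs' : 0 < 1 / (p - 1) := by apply one_div_pos.2; linarith
  have hm1 : 0 < min 1 (1 / (p - 1)) := lt_min one_pos hs'
  have hm2 : 0 < min 1 (p - 1) := lt_min one_pos (by linarith)
  set s := 1 / (p - 1) - 1 with hsdef
  set k := min 1 (1 / (p - 1)) * (w₀⁻¹ * K) ^ s * (w₀⁻¹ * (min 1 (p - 1) * (σ z₀ / 2))) with hk
  have hk0 : 0 < k := by positivity
  refine ⟨k / 2, half_pos hk0, eventually_half_le_of_sub_one_le hk0 hs ?_⟩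
  have h1 : ∀ᶠ z in 𝓝 z₀, σ z₀ / 2 < σ z :=
    hσc.continuousAt.eventually_const_lt (half_lt_self hσ0)
  filter_upwards [nhdsWithin_le_nhds h1, nhdsWithin_le_nhds hK, self_mem_nhdsWithin]
    with z hz1 hz2 hz3 x
  have hv := powField_ne_zero hp hc hne h0 hz3
  have hvpos := norm_pos_iff.2 hv
  refine le_trans (mul_le_mul_of_nonneg_right (sub_le_sub_right ?_ 1) (norm_nonneg x))
    (le_norm_fderiv_invBarycenter_apply hp1 hw₀ hc (fun _ => Or.inr hp) (Or.inl hv) x)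
  have h2 : (w₀⁻¹ * K) ^ s * ‖z - z₀‖ ^ s ≤ ‖w₀⁻¹ • powField (p - 2) c a z‖ ^ s := by
    rw [← Real.mul_rpow (by positivity) (norm_nonneg _), norm_smul,
      Real.norm_of_nonneg (by positivity)]
    refine Real.rpow_le_rpow_of_nonpos (by positivity) ?_ hs.le
    rw [mul_assoc]
    exact mul_le_mul_of_nonneg_left hz2 (by positivity)
  calc k * ‖z - z₀‖ ^ s
      = min 1 (1 / (p - 1)) * ((w₀⁻¹ * K) ^ s * ‖z - z₀‖ ^ s)
        * (w₀⁻¹ * (min 1 (p - 1) * (σ z₀ / 2))) := by rw [hk]; ring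
    _ ≤ min 1 (1 / (p - 1)) * ‖w₀⁻¹ • powField (p - 2) c a z‖ ^ s
        * (w₀⁻¹ * (min 1 (p - 1) * σ z)) := by gcongr

lemma memLp_density_iff_of_two_lt [Nontrivial (𝔼 d)] (hp : 2 < p) (hw : ∀ i, 0 < w i)
    (hBo : IsOpen B) (hB : Bornology.IsBounded B) (hne : ∃ i j, a i ≠ a j) {z₀ : 𝔼 d}
    (h0 : powField (p - 2) (fun i => w i.succ) a z₀ = 0) (hz₀ : z₀ ∈ B) (q : ℝ≥0∞)
    (hq : 1 ≤ q) :
    MemLp ((invBarycenter p (w 0) (fun i => w i.succ) a ⁻¹' B).indicator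
        (fun z => |(fderiv ℝ (invBarycenter p (w 0) (fun i => w i.succ) a) z).det|)) q volume
      ↔ q < ENNReal.ofReal ((p - 1) / (p - 2)) := by
  have hp1 : 1 < p := by linarith
  have hs := one_div_sub_one_neg hp
  have hUb := isBounded_preimage_invBarycenter (a := a) hp1 hw hB
  -- The zero of the field is a fixed point of the inverse map, so lying in B places the singularity
  -- in the support of the density.
  have hSz : invBarycenter p (w 0) (fun i => w i.succ) a z₀ = z₀ := by simp [invBarycenter, h0]
  obtain ⟨K, hK⟩ := exists_norm_fderiv_invBarycenter_le_of_two_lt hp (hw 0)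
    (fun j : Fin n => hw j.succ) hne h0 hUb
  obtain ⟨k, hk, hlow⟩ := exists_le_norm_fderiv_invBarycenter_of_two_lt hp (hw 0)
    (fun j : Fin n => hw j.succ) hne h0
  have hβ : (p - 1) / (p - 2) = 1 / -(1 / (p - 1) - 1) := by
    have h1 : p - 1 ≠ 0 := by linarith
    have h3 : -(1 / (p - 1) - 1) = (p - 2) / (p - 1) := by
      field_simp
      ring
    rw [h3, one_div_div]
  rw [hβ]
  refine memLp_indicator_det_iff (by linarith) hk
    (hBo.preimage (continuous_invBarycenter hp1 _ _)) hUb (fun _ : Unit => z₀)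
    (C := K) (fun z hz hzz => ?_) (by rwa [Set.mem_preimage, hSz]) ?_ q hq
  · simpa using hK z hz (hzz ())
  · simpa only [neg_neg] using hlow

lemma exists_norm_fderiv_invBarycenter_le_of_lt_two (hp1 : 1 < p) (hp : p < 2) (hw₀ : 0 < w₀)
    (hc : ∀ j, 0 < c j) {U : Set (𝔼 d)} (hU : Bornology.IsBounded U) :
    ∃ K, ∀ z ∈ U, (∀ j, z ≠ a j) → ‖fderiv ℝ (invBarycenter p w₀ c a) z‖
      ≤ K * (1 + ∑ j, ‖z - a j‖ ^ (-(2 - p))) := by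
  have hs : 0 < 1 / (p - 1) - 1 := by
    rw [sub_pos, lt_div_iff₀ (by linarith)]
    linarith
  have hfc : Continuous fun z => ‖w₀⁻¹ • powField (p - 2) c a z‖ ^ (1 / (p - 1) - 1) :=
    ((continuous_powField (by linarith : -1 < p - 2)).const_smul w₀⁻¹).norm.rpow_const
      fun _ => Or.inr hs.le
  obtain ⟨M, hM0, hM⟩ := exists_le_of_isBounded hfc hU
  have hcC : ∀ j, c j ≤ ∑ j, c j := fun j =>
    Finset.single_le_sum (f := c) (fun j _ => (hc j).le) (Finset.mem_univ j)
  set C := ∑ j, c j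
  set Q := (1 + |1 / (p - 1) - 1|) * M * (w₀⁻¹ * ((1 + |p - 2|) * C)) with hQ
  refine ⟨max 1 Q, fun z hz hzz => ?_⟩
  have h1 := norm_fderiv_invBarycenter_le (a := a) hp1 hw₀ hc (fun j => Or.inl (hzz j))
    (Or.inr hp)
  rw [neg_sub]
  set T := ∑ j, ‖z - a j‖ ^ (p - 2) with hT
  have hT0 : 0 ≤ T := Finset.sum_nonneg fun j _ => by positivity
  have h2 : ∑ j, c j * ‖z - a j‖ ^ (p - 2) ≤ C * T := by
    rw [hT, Finset.mul_sum]
    exact Finset.sum_le_sum fun j _ => mul_le_mul_of_nonneg_right (hcC j) (by positivity)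
  have h3 : 0 ≤ ∑ j, c j * ‖z - a j‖ ^ (p - 2) :=
    Finset.sum_nonneg fun j _ => mul_nonneg (hc j).le (by positivity)
  set A := ∑ j, c j * ‖z - a j‖ ^ (p - 2)
  calc _ ≤ _ := h1
    _ ≤ 1 + (1 + |1 / (p - 1) - 1|) * M * (w₀⁻¹ * ((1 + |p - 2|) * (C * T))) := by
        have := hM z hz
        gcongr
    _ = 1 + Q * T := by rw [hQ]; ring
    _ ≤ max 1 Q + max 1 Q * T := by
        gcongr
        · exact le_max_left _ _
        · exact le_max_right _ _
    _ = _ := by ring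

lemma exists_le_norm_fderiv_invBarycenter_of_lt_two (hp1 : 1 < p) (hp : p < 2) (hw₀ : 0 < w₀)
    (hc : ∀ j, 0 < c j) {i : Fin n} (hv : powField (p - 2) c a (a i) ≠ 0) :
    ∃ k > 0, ∀ᶠ z in 𝓝[≠] (a i), ∀ x,
      k * ‖z - a i‖ ^ (-(2 - p)) * ‖x‖ ≤ ‖fderiv ℝ (invBarycenter p w₀ c a) z x‖ := by
  have hs : 0 < 1 / (p - 1) - 1 := by
    rw [sub_pos, lt_div_iff₀ (by linarith)]
    linarith
  set f : (𝔼 d) → ℝ := fun z => ‖w₀⁻¹ • powField (p - 2) c a z‖ ^ (1 / (p - 1) - 1)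
  have hfc : Continuous f :=
    ((continuous_powField (by linarith : -1 < p - 2)).const_smul w₀⁻¹).norm.rpow_const
      fun _ => Or.inr hs.le
  have hfi : 0 < f (a i) :=
    Real.rpow_pos_of_pos (norm_pos_iff.2 (smul_ne_zero (inv_ne_zero hw₀.ne') hv)) _
  have hm1 : 0 < min 1 (1 / (p - 1)) := lt_min one_pos (by linarith)
  have hm2 : 0 < min 1 (p - 1) := lt_min one_pos (by linarith)
  set k := min 1 (1 / (p - 1)) * (f (a i) / 2) * (w₀⁻¹ * (min 1 (p - 1) * c i)) with hk
  have hci := hc i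
  have hk0 : 0 < k := by positivity
  refine ⟨k / 2, half_pos hk0, ?_⟩
  rw [neg_sub]
  refine eventually_half_le_of_sub_one_le hk0 (by linarith) ?_
  -- The outer factor stays away from zero near `a i`, since the field does not vanish there; the
  -- singularity is then that of the i-th summand.
  have h1 : ∀ᶠ z in 𝓝 (a i), f (a i) / 2 < f z :=
    hfc.continuousAt.eventually_const_lt (half_lt_self hfi)
  have h2 : ∀ᶠ z in 𝓝[≠] (a i), ∀ j, z ≠ a j := by
    rw [eventually_all]
    intro j
    rcases eq_or_ne (a i) (a j) with h | h
    · rw [h]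
      exact self_mem_nhdsWithin
    · exact nhdsWithin_le_nhds (isOpen_ne.mem_nhds h)
  filter_upwards [nhdsWithin_le_nhds h1, h2] with z hz1 hz2 x
  refine le_trans (mul_le_mul_of_nonneg_right (sub_le_sub_right ?_ 1) (norm_nonneg x))
    (le_norm_fderiv_invBarycenter_apply hp1 hw₀ hc (fun j => Or.inl (hz2 j)) (Or.inr hp) x)
  have h3 : c i * ‖z - a i‖ ^ (p - 2) ≤ ∑ j, c j * ‖z - a j‖ ^ (p - 2) :=
    Finset.single_le_sum (f := fun j => c j * ‖z - a j‖ ^ (p - 2))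
      (fun j _ => mul_nonneg (hc j).le (by positivity)) (Finset.mem_univ i)
  have hf0 : 0 ≤ f z := by positivity
  calc k * ‖z - a i‖ ^ (p - 2)
      = min 1 (1 / (p - 1)) * (f (a i) / 2)
        * (w₀⁻¹ * (min 1 (p - 1) * (c i * ‖z - a i‖ ^ (p - 2)))) := by rw [hk]; ring
    _ ≤ min 1 (1 / (p - 1)) * f z
        * (w₀⁻¹ * (min 1 (p - 1) * ∑ j, c j * ‖z - a j‖ ^ (p - 2))) := by
        gcongr

lemma memLp_density_iff_of_lt_two [Nontrivial (𝔼 d)] (hp1 : 1 < p) (hp : p < 2)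
    (hw : ∀ i, 0 < w i) (hBo : IsOpen B) (hB : Bornology.IsBounded B) {i : Fin n}
    (hv : powField (p - 2) (fun i => w i.succ) a (a i) ≠ 0)
    (hi : invBarycenter p (w 0) (fun i => w i.succ) a (a i) ∈ B) (q : ℝ≥0∞) (hq : 1 ≤ q) :
    MemLp ((invBarycenter p (w 0) (fun i => w i.succ) a ⁻¹' B).indicator
        (fun z => |(fderiv ℝ (invBarycenter p (w 0) (fun i => w i.succ) a) z).det|)) q volume
      ↔ q < ENNReal.ofReal (1 / (2 - p)) := by
  have hUb := isBounded_preimage_invBarycenter (a := a) hp1 hw hB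
  obtain ⟨K, hK⟩ := exists_norm_fderiv_invBarycenter_le_of_lt_two (a := a) hp1 hp (hw 0)
    (fun j : Fin n => hw j.succ) hUb
  obtain ⟨k, hk, hlow⟩ := exists_le_norm_fderiv_invBarycenter_of_lt_two hp1 hp (hw 0)
    (fun j : Fin n => hw j.succ) hv
  exact memLp_indicator_det_iff (by linarith) hk
    (hBo.preimage (continuous_invBarycenter hp1 _ _)) hUb a hK hi hlow q hq

lemma exists_ball_volume_eq_one [Nontrivial (𝔼 d)] (x : 𝔼 d) :
    ∃ R > 0, volume (Metric.ball x R) = 1 := by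
  set D := Module.finrank ℝ (𝔼 d) with hD
  have hd : 0 < D := Module.finrank_pos
  set V := (volume (Metric.ball (0 : 𝔼 d) 1)).toReal with hV
  have hVpos : 0 < V :=
    ENNReal.toReal_pos (Metric.measure_ball_pos _ _ one_pos).ne' measure_ball_lt_top.ne
  -- The radius solves R^D V = 1, where V is the volume of the unit ball.
  refine ⟨V⁻¹ ^ (1 / (D : ℝ)), by positivity, ?_⟩
  rw [Measure.addHaar_ball _ _ (by positivity), ← Real.rpow_natCast, ← Real.rpow_mul
    (by positivity), ← hD, one_div_mul_cancel (by positivity), Real.rpow_one,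
    ← ENNReal.ofReal_toReal (measure_ball_lt_top (μ := volume) (x := (0 : 𝔼 d)) (r := 1)).ne,
    ← hV, ← ENNReal.ofReal_mul (by positivity), inv_mul_cancel₀ hVpos.ne', ENNReal.ofReal_one]

theorem exists_isBarycenterDensity_of_two_lt [Nontrivial (𝔼 d)] (hp : 2 < p)
    (hw : ∀ i, 0 < w i) (hBo : IsOpen B) (hB : Bornology.IsBounded B) (hB1 : volume B = 1)
    (hne : ∃ i j, a i ≠ a j) {z₀ : 𝔼 d} (h0 : IsPointBarycenter p (fun i => w i.succ) a z₀)
    (hz₀ : z₀ ∈ B) :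
    ∃ g : (𝔼 d) → ℝ, IsBarycenterDensity p w (uniformAndDiracs B a) g ∧
      ∀ q : ℝ≥0∞, 1 ≤ q → (MemLp g q volume ↔ q < ENNReal.ofReal ((p - 1) / (p - 2))) := by
  have hp1 : 1 < p := by linarith
  rw [isPointBarycenter_iff hp1 fun i => hw _] at h0
  refine ⟨_, isBarycenterDensity_indicator hp1 hw hBo.measurableSet hB hB1
    (Set.finite_singleton z₀) fun z hz => ?_, memLp_density_iff_of_two_lt hp hw hBo hB hne h0 hz₀⟩
  exact (hasFDerivAt_invBarycenter hp1 (hw 0) (fun _ => Or.inr hp)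
    (Or.inl (powField_ne_zero hp (fun _ => hw _) hne h0 hz))).differentiableAt

theorem exists_isBarycenterDensity_of_lt_two [Nontrivial (𝔼 d)] (hp1 : 1 < p) (hp : p < 2)
    (hw : ∀ i, 0 < w i) (hBo : IsOpen B) (hB : Bornology.IsBounded B) (hB1 : volume B = 1)
    {i : Fin n} (hi : invBarycenter p (w 0) (fun i => w i.succ) a (a i) ∈ B)
    (hv : ¬ IsPointBarycenter p (fun i => w i.succ) a (a i)) :
    ∃ g : (𝔼 d) → ℝ, IsBarycenterDensity p w (uniformAndDiracs B a) g ∧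
      ∀ q : ℝ≥0∞, 1 ≤ q → (MemLp g q volume ↔ q < ENNReal.ofReal (1 / (2 - p))) := by
  rw [isPointBarycenter_iff hp1 fun i => hw _] at hv
  refine ⟨_, isBarycenterDensity_indicator hp1 hw hBo.measurableSet hB hB1
    (Set.finite_range a) fun z hz => ?_, memLp_density_iff_of_lt_two hp1 hp hw hBo hB hv hi⟩
  refine (hasFDerivAt_invBarycenter hp1 (hw 0) (fun j => Or.inl ?_) (Or.inr hp)).differentiableAt
  rintro rfl
  exact hz ⟨j, rfl⟩

/-- There are configurations whose barycenter density is not in `L^q` for some finite `q`. -/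
theorem exists_not_memLp_density [Nontrivial (𝔼 d)] (hn : 1 < n) (hp1 : 1 < p) (hp2 : p ≠ 2)
    (hw : ∀ i, 0 < w i) :
    ∃ (B : Set (𝔼 d)) (a : Fin n → 𝔼 d) (g : (𝔼 d) → ℝ) (q : ℝ≥0∞),
      IsOpen B ∧ Bornology.IsBounded B ∧ volume B = 1 ∧
        IsBarycenterDensity p w (uniformAndDiracs B a) g ∧ 1 < q ∧ q < ∞ ∧
        ¬ MemLp g q volume := by
  obtain ⟨e, he⟩ := exists_ne (0 : 𝔼 d)
  let i₀ : Fin n := ⟨0, by omega⟩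
  let i₁ : Fin n := ⟨1, hn⟩
  let a : Fin n → 𝔼 d := fun i => if i = i₀ then 0 else e
  have ha : a i₀ ≠ a i₁ := by
    have : i₁ ≠ i₀ := by simp [i₀, i₁]
    simp [a, this, he.symm]
  rcases lt_or_gt_of_ne hp2 with hp | hp
  -- Two distinct points cannot both be the unique minimizer.
  · obtain ⟨i, hi⟩ : ∃ i, ¬ IsPointBarycenter p (fun i => w i.succ) a (a i) := by
      by_contra! hall
      simp only [isPointBarycenter_iff hp1 fun i : Fin n => hw i.succ] at hall
      have h1 := pointCost_lt_of_powField_eq_zero hp1 (fun i => hw _) (by omega) (hall i₀) ha.symm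
      have h2 := pointCost_lt_of_powField_eq_zero hp1 (fun i => hw _) (by omega) (hall i₁) ha
      exact lt_asymm h1 h2
    -- Centring the ball at the image of `a i` makes `a i` a barycenter of a point of B; the
    -- critical exponent itself then serves as q.
    obtain ⟨R, hR, hvol⟩ := exists_ball_volume_eq_one
      (invBarycenter p (w 0) (fun i => w i.succ) a (a i))
    obtain ⟨g, hg, hgq⟩ := exists_isBarycenterDensity_of_lt_two hp1 hp hw Metric.isOpen_ball
      Metric.isBounded_ball hvol (Metric.mem_ball_self hR) hi
    have hq : 1 < ENNReal.ofReal (1 / (2 - p)) := by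
      rw [ENNReal.one_lt_ofReal, lt_div_iff₀ (by linarith)]
      linarith
    exact ⟨_, a, g, _, Metric.isOpen_ball, Metric.isBounded_ball, hvol, hg, hq,
      ENNReal.ofReal_lt_top, fun h => lt_irrefl _ ((hgq _ hq.le).1 h)⟩
  · obtain ⟨z₀, hz₀⟩ := exists_isPointBarycenter (x := a) hp1 (fun i => hw i.succ) (by omega)
    obtain ⟨R, hR, hvol⟩ := exists_ball_volume_eq_one z₀
    obtain ⟨g, hg, hgq⟩ := exists_isBarycenterDensity_of_two_lt hp hw Metric.isOpen_ball
      Metric.isBounded_ball hvol ⟨i₀, i₁, ha⟩ hz₀ (Metric.mem_ball_self hR)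
    have hq : 1 < ENNReal.ofReal ((p - 1) / (p - 2)) := by
      rw [ENNReal.one_lt_ofReal, lt_div_iff₀ (by linarith)]
      linarith
    exact ⟨_, a, g, _, Metric.isOpen_ball, Metric.isBounded_ball, hvol, hg, hq,
      ENNReal.ofReal_lt_top, fun h => lt_irrefl _ ((hgq _ hq.le).1 h)⟩

end Exponents

theorem mainTheorem7 (d n : ℕ) (hd : 1 ≤ d) (hn : 2 < n + 1)
    (p : ℝ) (hp : 1 < p) (hp2 : p ≠ 2)
    (w : Fin (n + 1) → ℝ) (hw : ∀ i, 0 < w i) (hw1 : ∑ i, w i = 1) :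
    -- superquadratic case
    (2 < p → ∀ (B : Set (EuclideanSpace ℝ (Fin d))) (xhat : Fin n → EuclideanSpace ℝ (Fin d))
      (zbar : EuclideanSpace ℝ (Fin d)),
      IsOpen B → Bornology.IsBounded B → volume B = 1 → (∃ i j, xhat i ≠ xhat j) →
      IsPointBarycenter p (fun i => w i.succ) xhat zbar → zbar ∈ B →
      ∃ g : EuclideanSpace ℝ (Fin d) → ℝ,
        IsBarycenterDensity p w (uniformAndDiracs B xhat) g ∧
        ∀ q : ℝ≥0∞, 1 ≤ q →
          (MemLp g q volume ↔ q < ENNReal.ofReal ((p - 1) / (p - 2)))) ∧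
    -- subquadratic case
    (p < 2 → ∀ (B : Set (EuclideanSpace ℝ (Fin d))) (xhat : Fin n → EuclideanSpace ℝ (Fin d)),
      IsOpen B → Bornology.IsBounded B → volume B = 1 → (∃ i j, xhat i ≠ xhat j) →
      (∃ i, (∃ x₁ ∈ B, IsPointBarycenter p w (Fin.cons x₁ xhat) (xhat i)) ∧
        ¬ IsPointBarycenter p (fun j => w j.succ) xhat (xhat i)) →
      ∃ g : EuclideanSpace ℝ (Fin d) → ℝ,
        IsBarycenterDensity p w (uniformAndDiracs B xhat) g ∧
        ∀ q : ℝ≥0∞, 1 ≤ q →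
          (MemLp g q volume ↔ q < ENNReal.ofReal (1 / (2 - p)))) ∧
    -- failure of regularity for a bounded, boundedly supported density
    (∃ (B : Set (EuclideanSpace ℝ (Fin d))) (xhat : Fin n → EuclideanSpace ℝ (Fin d))
      (g : EuclideanSpace ℝ (Fin d) → ℝ) (q : ℝ≥0∞),
      IsOpen B ∧ Bornology.IsBounded B ∧ volume B = 1 ∧
        IsBarycenterDensity p w (uniformAndDiracs B xhat) g ∧
        1 < q ∧ q < ∞ ∧ ¬ MemLp g q volume) := by
  have : NeZero d := ⟨by omega⟩
  refine ⟨fun hp B xhat zbar hBo hB hB1 hne hz hzB => ?_,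
    fun hp' B xhat hBo hB hB1 _ ⟨i, ⟨x₁, hx₁, hx⟩, hi⟩ => ?_, ?_⟩
  · exact exists_isBarycenterDensity_of_two_lt hp hw hBo hB hB1 hne hz hzB
  · rw [isPointBarycenter_cons_iff hp hw] at hx
    -- Being the barycenter for some x₁ in B means that the inverse map sends `xhat i` to x₁, hence
    -- into B.
    exact exists_isBarycenterDensity_of_lt_two hp hp' hw hBo hB hB1 (hx ▸ hx₁) hi
  · exact exists_not_memLp_density (by omega) hp hp2 hw
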